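/- Notation. For $f:\mathbb C\to\mathbb C$ put $\partial_z f=\tfrac12(\partial_x-i\partial_y)f$ and $\partial_{\bar z}f=\tfrac12(\partial_x+i\partial_y)f$; let $(\mathcal C f)(z)=\frac1\pi\int_{\mathbb C}\frac{f(w)}{z-w}\,d^2w$ be the Cauchy transform ($d^2w$ is Lebesgue measure) and $\mathcal B=\partial_z\mathcal C$ the Beltrami transform. For functions of $(z,\epsilon)\in\mathbb C\times\mathbb R$ these operators act in $z$ with $\epsilon$ fixed, and for $l=(l_1,l_2,l_3)\in\mathbb N^3$ let $D^l=\partial_\epsilon^{l_1}\partial_z^{l_2}\partial_{\bar z}^{l_3}$. "Smooth" means $C^\infty$ in the real sense. $\hat{\mathbb C}=\mathbb C\cup\{\infty\}$ is the Riemann sphere, with the smooth structure given by the charts $z$ and $1/z$. **Proposition 3.1.** Let $\mu:\mathbb C\times\mathbb R\to\mathbb C$ be smooth with compact support and $\|\mu\|_{L^\infty(\mathbb C\times\mathbb R)}<1$. Put $$v_n=(\mu\mathcal B)^n\mu,\qquad u_n=\mathcal C v_n,\qquad u=\sum_{n=0}^\infty u_n .$$ Then: 1. Each $v_n$ is smooth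 and compactly supported on $\mathbb C\times\mathbb R$, each $u_n$ is smooth on $\mathbb C\times\mathbb R$, and the series $\sum_n u_n$ converges uniformly on $\mathbb C\times\mathbb R$ together with all its derivatives: $u$ is smooth on $\mathbb C\times\mathbb R$, and for every $l$, $\sum_{n<N}D^lu_n\to D^lu$ uniformly on $\mathbb C\times\mathbb R$ as $N\to\infty$. The sum satisfies $(1-\mathcal C\mu\partial_z)u=\mathcal C\mu$. 2. For every $l$ there is a constant $C_l$ (depending on $\mu$ and $l$ only) such that for all $z\in\mathbb C$, $\epsilon\in\mathbb R$ and $n\ge0$, $$|D^lu(z,\epsilon)|\le C_l(1+|z|)^{-1},\qquad |D^lu_n(z,\epsilon)|\le C_l(1+|z|)^{-1}.$$ 3. For every $\epsilon\in\mathbb R$ the map $\psi(z,\epsilon)=z+u(z,\epsilon)$, extended by $\psi(\infty,\epsilon)=\infty$, is a smooth diffeomorphism of $\hat{\mathbb C}$. -/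

import Mathlib

open scoped ContDiff Manifold Topology

namespace RiemannSphere

open Filter Bornology

open Classical in
/-- The inversion `z ↦ 1 / z` of `ℂ ∪ {∞}`, exchanging `0` and `∞`. -/
noncomputable def inversion (p : OnePoint ℂ) : OnePoint ℂ :=
  p.elim ((0 : ℂ) : OnePoint ℂ)
    (fun z => if z = 0 then OnePoint.infty else ((z⁻¹ : ℂ) : OnePoint ℂ))

theorem inversion_infty : inversion OnePoint.infty = ((0 : ℂ) : OnePoint ℂ) := rfl

theorem inversion_zero : inversion ((0 : ℂ) : OnePoint ℂ) = OnePoint.infty := by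
  simp [inversion]

theorem inversion_coe {z : ℂ} (hz : z ≠ 0) :
    inversion (z : OnePoint ℂ) = ((z⁻¹ : ℂ) : OnePoint ℂ) := by
  simp [inversion, hz]

theorem inversion_involutive : Function.Involutive inversion := by
  intro p
  induction p using OnePoint.rec with
  | infty => rw [inversion_infty, inversion_zero]
  | coe z =>
    by_cases hz : z = 0
    · subst hz
      rw [inversion_zero, inversion_infty]
    · rw [inversion_coe hz, inversion_coe (inv_ne_zero hz), inv_inv]

theorem continuous_inversion : Continuous inversion := by
  have hcc : coclosedCompact ℂ = cobounded ℂ := by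
    rw [coclosedCompact_eq_cocompact, Metric.cobounded_eq_cocompact]
  rw [continuous_iff_continuousAt]
  intro p
  induction p using OnePoint.rec with
  | infty =>
    rw [OnePoint.continuousAt_infty', hcc, inversion_infty]
    have h : Tendsto (fun z : ℂ => ((z⁻¹ : ℂ) : OnePoint ℂ)) (cobounded ℂ)
        (𝓝 ((0 : ℂ) : OnePoint ℂ)) :=
      (OnePoint.continuous_coe.tendsto (0 : ℂ)).comp tendsto_inv₀_cobounded
    refine h.congr' ?_
    filter_upwards [eventually_ne_cobounded (0 : ℂ)] with z hz
    exact (inversion_coe hz).symm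
  | coe z =>
    rw [OnePoint.continuousAt_coe]
    by_cases hz : z = 0
    · subst hz
      rw [← continuousWithinAt_compl_self, ContinuousWithinAt, Function.comp_apply,
        inversion_zero]
      have h : Tendsto (fun z : ℂ => ((z⁻¹ : ℂ) : OnePoint ℂ)) (𝓝[≠] 0)
          (𝓝 OnePoint.infty) :=
        (hcc ▸ OnePoint.tendsto_coe_infty).comp tendsto_inv₀_nhdsNE_zero
      refine h.congr' ?_
      filter_upwards [self_mem_nhdsWithin] with w hw
      exact (inversion_coe hw).symm
    · have h : ContinuousAt (fun w : ℂ => ((w⁻¹ : ℂ) : OnePoint ℂ)) z :=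
        OnePoint.continuous_coe.continuousAt.comp (continuousAt_inv₀ hz)
      refine h.congr ?_
      filter_upwards [isOpen_ne.mem_nhds hz] with w hw
      exact (inversion_coe hw).symm

/-- The inversion as a homeomorphism of `ℂ ∪ {∞}`. -/
noncomputable def inversionHomeomorph : OnePoint ℂ ≃ₜ OnePoint ℂ where
  toEquiv := inversion_involutive.toPerm
  continuous_toFun := continuous_inversion
  continuous_invFun := continuous_inversion

/-- The affine chart `z` of the Riemann sphere, defined away from `∞`. -/
noncomputable def affineChart : OpenPartialHomeomorph (OnePoint ℂ) ℂ :=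
  ((OnePoint.isOpenEmbedding_coe (X := ℂ)).toOpenPartialHomeomorph
    ((↑) : ℂ → OnePoint ℂ)).symm

/-- The chart `1 / z` of the Riemann sphere at `∞`, defined away from `0`. -/
noncomputable def inftyChart : OpenPartialHomeomorph (OnePoint ℂ) ℂ :=
  inversionHomeomorph.transOpenPartialHomeomorph affineChart

theorem affineChart_coe (z : ℂ) : affineChart (z : OnePoint ℂ) = z :=
  (OnePoint.isOpenEmbedding_coe (X := ℂ)).toOpenPartialHomeomorph_left_inv

theorem affineChart_symm (z : ℂ) : affineChart.symm z = (z : OnePoint ℂ) := rfl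

theorem affineChart_source : affineChart.source = {OnePoint.infty}ᶜ := by
  rw [OnePoint.compl_infty]
  simp [affineChart]

theorem affineChart_target : affineChart.target = Set.univ := by
  simp [affineChart]

theorem inftyChart_apply (p : OnePoint ℂ) : inftyChart p = affineChart (inversion p) := rfl

theorem inftyChart_symm (z : ℂ) : inftyChart.symm z = inversion (z : OnePoint ℂ) := rfl

theorem inftyChart_source : inftyChart.source = {((0 : ℂ) : OnePoint ℂ)}ᶜ := by
  have h : inftyChart.source = inversion ⁻¹' affineChart.source := rfl
  rw [h, affineChart_source]
  ext p
  simp only [Set.mem_preimage, Set.mem_compl_iff, Set.mem_singleton_iff]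
  rw [← inversion_zero, inversion_involutive.injective.eq_iff]

theorem inftyChart_target : inftyChart.target = Set.univ := affineChart_target

open Classical in
/-- The Riemann sphere `ℂ ∪ {∞}` with the atlas formed by the charts `z` and `1 / z`. -/
noncomputable instance : ChartedSpace ℂ (OnePoint ℂ) where
  atlas := {affineChart, inftyChart}
  chartAt p := if p = OnePoint.infty then inftyChart else affineChart
  mem_chart_source p := by
    split_ifs with h
    · rw [inftyChart_source, h]
      exact OnePoint.infty_ne_coe 0
    · rw [affineChart_source]
      exact h
  chart_mem_atlas p := by
    split_ifs <;> simp

/-- The Riemann sphere is a smooth real surface: the transition map is `z ↦ 1 / z`. -/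
instance : IsManifold 𝓘(ℝ, ℂ) ∞ (OnePoint ℂ) := by
  have hinv : ContDiffOn ℝ ∞ (fun z : ℂ => z⁻¹) {0}ᶜ := fun z hz =>
    (contDiffAt_inv ℝ hz).contDiffWithinAt
  apply isManifold_of_contDiffOn
  rintro e e' (rfl | rfl) (rfl | rfl)
  · refine contDiffOn_id.congr fun z _ => ?_
    simp [affineChart_symm, affineChart_coe]
  · refine (hinv.congr (f₁ := fun z : ℂ => inftyChart (affineChart.symm z))
      fun z hz => ?_).mono fun z hz => ?_
    · rw [affineChart_symm, inftyChart_apply, inversion_coe hz, affineChart_coe]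
    · simpa [inftyChart_source, affineChart_symm, affineChart_target] using hz
  · refine (hinv.congr (f₁ := fun z : ℂ => affineChart (inftyChart.symm z))
      fun z hz => ?_).mono fun z hz => ?_
    · rw [inftyChart_symm, inversion_coe hz, affineChart_coe]
    · have h : inversion (z : OnePoint ℂ) ≠ OnePoint.infty := by
        simpa [affineChart_source, inftyChart_symm, inftyChart_target] using hz
      rintro (rfl : z = 0)
      exact h inversion_zero
  · refine contDiffOn_id.congr fun z _ => ?_
    simp [inftyChart_symm, inftyChart_apply, inversion_involutive _, affineChart_coe]

end RiemannSphere

namespace Beltrami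

open MeasureTheory

/-- `∂_z f = (∂_x f - i ∂_y f) / 2`. -/
noncomputable def dz (f : ℂ → ℂ) (z : ℂ) : ℂ :=
  (fderiv ℝ f z 1 - Complex.I * fderiv ℝ f z Complex.I) / 2

/-- `∂_{z̄} f = (∂_x f + i ∂_y f) / 2`. -/
noncomputable def dzbar (f : ℂ → ℂ) (z : ℂ) : ℂ :=
  (fderiv ℝ f z 1 + Complex.I * fderiv ℝ f z Complex.I) / 2

/-- The Cauchy transform `(𝒞 f)(z) = π⁻¹ ∫ f(w) / (z - w) d²w`. -/
noncomputable def cauchy (f : ℂ → ℂ) (z : ℂ) : ℂ :=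
  (1 / (Real.pi : ℂ)) * ∫ w : ℂ, f w / (z - w)

/-- The Beltrami transform `ℬ = ∂_z 𝒞`. -/
noncomputable def beltrami (f : ℂ → ℂ) : ℂ → ℂ := dz (cauchy f)

/-- For a single coefficient `m`, the function `(m ℬ)ⁿ m` on the plane. -/
noncomputable def iterate (m : ℂ → ℂ) (n : ℕ) : ℂ → ℂ :=
  (fun (f : ℂ → ℂ) (z : ℂ) => m z * beltrami f z)^[n] m

/-- `v_n(z, ε) = ((μ ℬ)ⁿ μ)(z, ε)`, the operators acting in `z` at fixed `ε`. -/
noncomputable def v (μ : ℂ × ℝ → ℂ) (n : ℕ) (p : ℂ × ℝ) : ℂ :=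
  iterate (fun w => μ (w, p.2)) n p.1

/-- `u_n = 𝒞 v_n`, the operator acting in `z` at fixed `ε`. -/
noncomputable def uTerm (μ : ℂ × ℝ → ℂ) (n : ℕ) (p : ℂ × ℝ) : ℂ :=
  cauchy (fun w => v μ n (w, p.2)) p.1

/-- The sum `u = ∑ u_n` of the Neumann series. -/
noncomputable def uSum (μ : ℂ × ℝ → ℂ) (p : ℂ × ℝ) : ℂ := ∑' n, uTerm μ n p

/-- `∂_ε` on functions of `(z, ε)`. -/
noncomputable def partialEps (F : ℂ × ℝ → ℂ) (p : ℂ × ℝ) : ℂ :=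
  deriv (fun t : ℝ => F (p.1, t)) p.2

/-- `∂_z` on functions of `(z, ε)`. -/
noncomputable def partialZ (F : ℂ × ℝ → ℂ) (p : ℂ × ℝ) : ℂ :=
  dz (fun w => F (w, p.2)) p.1

/-- `∂_{z̄}` on functions of `(z, ε)`. -/
noncomputable def partialZbar (F : ℂ × ℝ → ℂ) (p : ℂ × ℝ) : ℂ :=
  dzbar (fun w => F (w, p.2)) p.1

/-- `D^l = ∂_ε^{l₁} ∂_z^{l₂} ∂_{z̄}^{l₃}` for a multi-index `l = (l₁, l₂, l₃)`. -/
noncomputable def D (l : ℕ × ℕ × ℕ) (F : ℂ × ℝ → ℂ) : ℂ × ℝ → ℂ :=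
  partialEps^[l.1] (partialZ^[l.2.1] (partialZbar^[l.2.2] F))

end Beltrami

namespace Beltrami

open MeasureTheory Set Filter

/-! ### The Cauchy transform as a convolution -/

/-! On smooth compactly supported functions the Cauchy transform is a right inverse of `∂_{z̄}`, and
it commutes with every derivative, being convolution with a locally integrable kernel. Integration
by parts then shows that `ℬ = ∂_z 𝒞` preserves the `L²` norm (`integral_norm_beltrami_sq`), so
multiplication by `μ` after `ℬ` contracts `L²` by a factor `k < 1`, uniformly in `ε`.

Derivatives are handled by differentiating the recursion `v_{n+1} = μ ℬ v_n`. A derivative of `v_n`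
obeys the same recursion with a source built from lower-order derivatives, which already decay
geometrically; a geometric source costs only a slightly larger ratio `r < 1` (`GeomL2.of_recursion`,
`Ders.of_recursion`). Two further derivatives turn `L²` decay into uniform decay, because `|f|` is
at most the integral of `|∂_x ∂_y f|`. The Cauchy transform of a function supported in a fixed disc
is bounded by its supremum times a constant multiple of `(1 + |z|)⁻¹`. Hence every derivative of
`u_n` is at most `C qⁿ (1 + |z|)⁻¹`, which gives smoothness, uniform convergence and decay together.

Termwise, `∂_{z̄} u = μ (1 + ∂_z u)`, and Liouville's theorem turns this into the integral equation.
For the diffeomorphism, the essential point is that `P = 1 + ∂_z u` has no zero: its logarithm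
should solve `∂_{z̄} σ = ∂_z μ + μ ∂_z σ`, an equation solved by the same Neumann series. The
function `P exp(-σ) - 1` then solves the homogeneous Beltrami equation and vanishes at infinity, so
it is zero (`one_add_partialZ_solution_ne_zero`). Since `|μ| < 1`, the differential of `ψ` is
invertible everywhere. A proper local homeomorphism of the plane with one value taken only once is
bijective; such a value exists far out, where `ψ` is close to the identity. At `∞`, `u` is
holomorphic, and Riemann's removable singularity theorem gives smoothness in the chart `1/z`. -/

theorem integrableOn_inv_ball : IntegrableOn (fun w : ℂ => w⁻¹) (Metric.ball 0 1) := by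
  have h : IntegrableOn (fun w : ℂ => (‖w‖)⁻¹) (Metric.ball (0 : ℂ) 1) := by
    refine (integrableOn_fun_norm_addHaar (E := ℂ) volume (f := fun x : ℝ => x⁻¹)).2 ?_
    rw [Complex.finrank_real_complex]
    -- In polar coordinates the weight `r` cancels the singularity `r⁻¹`.
    refine (integrableOn_const (C := (1 : ℝ)) (by simp)).congr_fun (fun x hx => ?_)
      measurableSet_Ioo
    simp [hx.1.ne']
  refine (integrable_norm_iff ?_).1 (by simpa [IntegrableOn] using h)
  exact (measurable_inv (G := ℂ)).aestronglyMeasurable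

theorem locallyIntegrable_inv : LocallyIntegrable (fun w : ℂ => w⁻¹) := by
  rw [locallyIntegrable_iff]
  intro K hK
  have h2 : IntegrableOn (fun w : ℂ => w⁻¹) (K \ Metric.ball 0 1) := by
    refine ContinuousOn.integrableOn_compact (hK.diff Metric.isOpen_ball) ?_
    refine continuousOn_inv₀.mono fun z hz => ?_
    rintro rfl
    exact hz.2 (by simp)
  refine (integrableOn_inv_ball.union h2).mono_set fun z hz => ?_
  by_cases h : z ∈ Metric.ball (0 : ℂ) 1
  · exact Or.inl h
  · exact Or.inr ⟨hz, h⟩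

/-- The Cauchy kernel `1 / (π w)`. -/
noncomputable def kernel (w : ℂ) : ℂ := (1 / (Real.pi : ℂ)) * w⁻¹

theorem locallyIntegrable_kernel : LocallyIntegrable kernel :=
  locallyIntegrable_inv.smul (1 / (Real.pi : ℂ))

open scoped Convolution

theorem cauchy_eq_convolution (f : ℂ → ℂ) (z : ℂ) :
    cauchy f z = (kernel ⋆[ContinuousLinearMap.mul ℝ ℂ, volume] f) z := by
  rw [convolution_eq_swap, cauchy, ← integral_const_mul]
  congr 1
  ext w
  simp [kernel]
  ring

theorem cauchy_eq_integral (f : ℂ → ℂ) (z : ℂ) :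
    cauchy f z = (1 / (Real.pi : ℂ)) * ∫ w : ℂ, f (z - w) / w := by
  rw [cauchy_eq_convolution, convolution_def, ← integral_const_mul]
  congr 1
  ext w
  simp [kernel]
  ring

/-- The Cauchy transform in `z` at fixed `ε`. -/
noncomputable def cauchyParam (F : ℂ × ℝ → ℂ) (p : ℂ × ℝ) : ℂ :=
  cauchy (fun w => F (w, p.2)) p.1

section Param

variable {F : ℂ × ℝ → ℂ} {R : ℝ}

theorem cauchyParam_eq (F : ℂ × ℝ → ℂ) : cauchyParam F =
    (fun q : ℝ × ℂ => (kernel ⋆[ContinuousLinearMap.mul ℝ ℂ, volume]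
      (fun w => F (w, q.1))) q.2) ∘ Prod.swap := by
  ext p
  exact cauchy_eq_convolution _ _

theorem contDiff_cauchyParam (hF : ContDiff ℝ ∞ F) (hR : ∀ p, R < ‖p.1‖ → F p = 0) :
    ContDiff ℝ ∞ (cauchyParam F) := by
  rw [cauchyParam_eq]
  have h := contDiffOn_convolution_right_with_param (n := ⊤) (ContinuousLinearMap.mul ℝ ℂ)
    (g := fun (e : ℝ) (w : ℂ) => F (w, e)) (s := univ) isOpen_univ
    (isCompact_closedBall (0 : ℂ) R) (fun e w _ hw => hR _ (by simpa using hw))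
    locallyIntegrable_kernel (hF.comp (contDiff_snd.prodMk contDiff_fst)).contDiffOn
  rw [univ_prod_univ, contDiffOn_univ] at h
  exact h.comp (contDiff_snd.prodMk contDiff_fst)

/-- A derivative of a convolution may fall on the smooth factor. The direction `e` may have an `ε`
component; only the support in `z` has to be bounded for this. -/
theorem fderiv_cauchyParam (hF : ContDiff ℝ ∞ F) (hR : ∀ p, R < ‖p.1‖ → F p = 0)
    (p e : ℂ × ℝ) :
    fderiv ℝ (cauchyParam F) p e = cauchyParam (fun q => fderiv ℝ F q e) p := by
  have hsw : ∀ q : ℝ × ℂ, HasFDerivAt (Prod.swap : ℝ × ℂ → ℂ × ℝ)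
      (ContinuousLinearEquiv.prodComm ℝ ℝ ℂ : ℝ × ℂ →L[ℝ] ℂ × ℝ) q := fun q =>
    (ContinuousLinearEquiv.prodComm ℝ ℝ ℂ).hasFDerivAt
  have hsw' : ∀ q : ℂ × ℝ, HasFDerivAt (Prod.swap : ℂ × ℝ → ℝ × ℂ)
      (ContinuousLinearEquiv.prodComm ℝ ℂ ℝ : ℂ × ℝ →L[ℝ] ℝ × ℂ) q := fun q =>
    (ContinuousLinearEquiv.prodComm ℝ ℂ ℝ).hasFDerivAt
  have hG : ContDiff ℝ ∞ (F ∘ (Prod.swap : ℝ × ℂ → ℂ × ℝ)) :=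
    hF.comp (contDiff_snd.prodMk contDiff_fst)
  have hsupp : ∀ (e : ℝ), ∀ w ∉ Metric.closedBall (0 : ℂ) R, F (w, e) = 0 :=
    fun e w hw => hR _ (by simpa using hw)
  have h := hasFDerivAt_convolution_right_with_param (ContinuousLinearMap.mul ℝ ℂ)
    (g := fun (e : ℝ) (w : ℂ) => F (w, e)) (s := univ) isOpen_univ
    (isCompact_closedBall (0 : ℂ) R) (fun e w _ hw => hsupp e w hw)
    locallyIntegrable_kernel (hG.of_le (by simp)).contDiffOn p.swap (mem_univ _)
  have h2 := h.comp p (hsw' p)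
  rw [cauchyParam_eq, h2.fderiv]
  have hd : ∀ q : ℝ × ℂ, ∀ e, fderiv ℝ (F ∘ (Prod.swap : ℝ × ℂ → ℂ × ℝ)) q e =
      fderiv ℝ F q.swap e.swap := by
    intro q e
    rw [((hF.differentiable (by simp)).differentiableAt.hasFDerivAt.comp q (hsw q)).fderiv]
    rfl
  have hcont : Continuous (fun w : ℂ => fderiv ℝ (F ∘ (Prod.swap : ℝ × ℂ → ℂ × ℝ)) (p.2, w)) :=
    (hG.continuous_fderiv (by simp)).comp (by fun_prop)
  have hcs : HasCompactSupport
      (fun w : ℂ => fderiv ℝ (F ∘ (Prod.swap : ℝ × ℂ → ℂ × ℝ)) (p.2, w)) := by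
    refine HasCompactSupport.intro (isCompact_closedBall (0 : ℂ) R) fun w hw => ?_
    have : F ∘ (Prod.swap : ℝ × ℂ → ℂ × ℝ) =ᶠ[𝓝 (p.2, w)] fun _ => 0 := by
      have ho : IsOpen {q : ℝ × ℂ | R < ‖q.2‖} := isOpen_lt (by fun_prop) (by fun_prop)
      filter_upwards [ho.mem_nhds (show R < ‖w‖ by simpa using hw)] with q hq
      exact hR _ hq
    rw [this.fderiv_eq]
    simp
  rw [cauchyParam, cauchy_eq_convolution]
  refine (convolution_precompR_apply (ContinuousLinearMap.mul ℝ ℂ) locallyIntegrable_kernel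
    hcs hcont p.1 e.swap).trans ?_
  simp only [hd]
  rfl

end Param

section OneVar

variable {f : ℂ → ℂ}

theorem exists_radius (hs : HasCompactSupport f) : ∃ R : ℝ, 0 ≤ R ∧ ∀ z, R < ‖z‖ → f z = 0 := by
  obtain ⟨R, hR⟩ := hs.isCompact.isBounded.subset_closedBall 0
  refine ⟨max R 0, le_max_right _ _, fun z hz => ?_⟩
  by_contra h
  have := hR (subset_tsupport f h)
  simp at this
  exact absurd (lt_of_le_of_lt (le_max_left R 0) hz) (not_lt.2 this)

theorem contDiff_cauchy (hf : ContDiff ℝ ∞ f) (hs : HasCompactSupport f) :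
    ContDiff ℝ ∞ (cauchy f) := by
  have h1 : cauchy f = (kernel ⋆[ContinuousLinearMap.mul ℝ ℂ, volume] f) := by
    ext z; exact cauchy_eq_convolution f z
  rw [h1]
  exact hs.contDiff_convolution_right _ locallyIntegrable_kernel (n := ⊤) hf

theorem fderiv_cauchy (hf : ContDiff ℝ ∞ f) (hs : HasCompactSupport f) (z e : ℂ) :
    fderiv ℝ (cauchy f) z e = cauchy (fun w => fderiv ℝ f w e) z := by
  rw [cauchy_eq_convolution]
  have h := hs.hasFDerivAt_convolution_right (ContinuousLinearMap.mul ℝ ℂ)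
    locallyIntegrable_kernel (hf.of_le (by simp)) z
  have h1 : cauchy f = (kernel ⋆[ContinuousLinearMap.mul ℝ ℂ, volume] f) := by
    ext z; exact cauchy_eq_convolution f z
  rw [h1, h.fderiv]
  exact convolution_precompR_apply _ locallyIntegrable_kernel (hs.fderiv ℝ)
    (hf.continuous_fderiv (by simp)) z e

theorem integrable_cauchy_integrand (hf : Continuous f) (hs : HasCompactSupport f) (z : ℂ) :
    Integrable (fun w => f w / (z - w)) := by
  have h := (hs.convolutionExists_right (ContinuousLinearMap.mul ℝ ℂ) locallyIntegrable_inv hf z)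
  have h2 := h.integrable_swap
  refine h2.congr (Eventually.of_forall fun w => ?_)
  simp
  ring

theorem cauchy_add {g : ℂ → ℂ} (hf : Continuous f) (hs : HasCompactSupport f)
    (hg : Continuous g) (hgs : HasCompactSupport g) (z : ℂ) :
    cauchy (fun w => f w + g w) z = cauchy f z + cauchy g z := by
  simp only [cauchy, add_div]
  rw [integral_add (integrable_cauchy_integrand hf hs z) (integrable_cauchy_integrand hg hgs z)]
  ring

theorem cauchy_const_mul (c : ℂ) (f : ℂ → ℂ) (z : ℂ) :
    cauchy (fun w => c * f w) z = c * cauchy f z := by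
  simp only [cauchy, mul_div_assoc]
  rw [integral_const_mul]
  ring

end OneVar

/-! ### The Cauchy transform inverts `∂_{z̄}` -/

section Pompeiu

variable {f : ℂ → ℂ}

/-- The unit vector `cos θ + i sin θ`. -/
noncomputable def unitVec (θ : ℝ) : ℂ := Real.cos θ + Real.sin θ * Complex.I

theorem continuous_unitVec : Continuous unitVec := by
  unfold unitVec
  fun_prop

theorem norm_unitVec (θ : ℝ) : ‖unitVec θ‖ = 1 := by
  have : unitVec θ = Complex.exp (θ * Complex.I) := by
    rw [Complex.exp_mul_I, unitVec]
    simp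
  rw [this, Complex.norm_exp_ofReal_mul_I]

theorem unitVec_ne_zero (θ : ℝ) : unitVec θ ≠ 0 := by
  intro h
  have := norm_unitVec θ
  simp [h] at this

theorem hasDerivAt_unitVec (θ : ℝ) : HasDerivAt unitVec (Complex.I * unitVec θ) θ := by
  have h1 := (Real.hasDerivAt_cos θ).ofReal_comp
  have h2 := ((Real.hasDerivAt_sin θ).ofReal_comp).mul_const Complex.I
  have h := h1.add h2
  refine HasDerivAt.congr_deriv (f := unitVec) h ?_
  simp only [unitVec]
  push_cast
  linear_combination (-(Complex.sin θ : ℂ)) * Complex.I_mul_I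

/-- This is `∂_{z̄}` written in the rotated orthonormal frame: radial direction `unitVec θ`, angular
direction `I * unitVec θ`. -/
theorem dzbar_div_unitVec (z : ℂ) (θ : ℝ) : dzbar f z / unitVec θ =
    (fderiv ℝ f z (unitVec θ) + Complex.I * fderiv ℝ f z (Complex.I * unitVec θ)) / 2 := by
  have h1 : unitVec θ = Real.cos θ • (1 : ℂ) + Real.sin θ • Complex.I := by
    simp [unitVec]
  have h2 : Complex.I * unitVec θ = Real.cos θ • Complex.I + (-Real.sin θ) • (1 : ℂ) := by
    simp [unitVec]
    linear_combination (Complex.sin θ : ℂ) * Complex.I_mul_I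
  rw [div_eq_iff (unitVec_ne_zero θ), h2, h1, map_add, map_add, map_smul, map_smul, map_smul,
    map_smul, dzbar]
  have h3 : ((Real.cos θ : ℝ) : ℂ) ^ 2 + ((Real.sin θ : ℝ) : ℂ) ^ 2 = 1 := by
    exact_mod_cast Real.cos_sq_add_sin_sq θ
  simp only [Complex.real_smul]
  push_cast at h3 ⊢
  linear_combination (-1/2 : ℂ) * (fderiv ℝ f z 1 + Complex.I * fderiv ℝ f z Complex.I) * h3 +
    (-1/2 : ℂ) * (-fderiv ℝ f z 1 * (Complex.sin θ) ^ 2 +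
      fderiv ℝ f z Complex.I * Complex.cos θ * Complex.sin θ) * Complex.I_mul_I

/-- With the derivative moved onto `f`, polar coordinates centred at `z` cancel the kernel against
the Jacobian. The radial part of `∂_{z̄} f` integrates to `f z` along each ray; the angular part is
the derivative of a periodic function and integrates to zero over each circle. -/
theorem dzbar_cauchy (hf : ContDiff ℝ ∞ f) (hs : HasCompactSupport f) (z : ℂ) :
    dzbar (cauchy f) z = f z := by
  have hfd : Differentiable ℝ f := hf.differentiable (by simp)
  have hc : Continuous (fderiv ℝ f) := hf.continuous_fderiv (by simp)
  have hce : ∀ e : ℂ, Continuous (fun w => fderiv ℝ f w e) := fun e => by fun_prop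
  have hse : ∀ e : ℂ, HasCompactSupport (fun w => fderiv ℝ f w e) := fun e =>
    hs.fderiv_apply ℝ e
  have h1 : dzbar (cauchy f) z = cauchy (dzbar f) z := by
    have : dzbar f = fun w => (1 / 2 : ℂ) *
        (fderiv ℝ f w 1 + Complex.I * fderiv ℝ f w Complex.I) := by
      ext w; rw [dzbar]; ring
    rw [this, cauchy_const_mul, cauchy_add (hce 1) (hse 1)
      (g := fun w => Complex.I * fderiv ℝ f w Complex.I) (continuous_const.mul (hce _))
      ((hse _).mul_left), cauchy_const_mul, dzbar, fderiv_cauchy hf hs, fderiv_cauchy hf hs]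
    ring
  rw [h1, cauchy_eq_integral, ← Complex.integral_comp_polarCoord_symm, polarCoord_target]
  obtain ⟨R, hR0, hR⟩ := exists_radius hs
  have hDR : ∀ w, R < ‖w‖ → fderiv ℝ f w = 0 := by
    intro w hw
    have : f =ᶠ[𝓝 w] fun _ => 0 := by
      have ho : IsOpen {q : ℂ | R < ‖q‖} := isOpen_lt (by fun_prop) (by fun_prop)
      filter_upwards [ho.mem_nhds hw] with q hq
      exact hR _ hq
    rw [this.fderiv_eq]
    simp
  -- `-A` is the `r`-derivative and `-r B` the `θ`-derivative of `f (z - r * unitVec θ)`.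
  set A : ℝ × ℝ → ℂ := fun p => fderiv ℝ f (z - p.1 * unitVec p.2) (unitVec p.2) with hA
  set B : ℝ × ℝ → ℂ := fun p => fderiv ℝ f (z - p.1 * unitVec p.2)
    (Complex.I * unitVec p.2) with hB
  have hu := continuous_unitVec
  have hAc : Continuous A := by
    have : Continuous (fun p : ℝ × ℝ => fderiv ℝ f (z - p.1 * unitVec p.2)) :=
      hc.comp (by fun_prop)
    exact this.clm_apply (by fun_prop)
  have hBc : Continuous B := by
    have : Continuous (fun p : ℝ × ℝ => fderiv ℝ f (z - p.1 * unitVec p.2)) :=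
      hc.comp (by fun_prop)
    exact this.clm_apply (by fun_prop)
  have hfar : ∀ r θ : ℝ, ‖z‖ + R < |r| → R < ‖z - r * unitVec θ‖ := by
    intro r θ hr
    have h3 : ‖(r : ℂ) * unitVec θ‖ = |r| := by
      rw [norm_mul, norm_unitVec]; simp
    have := norm_sub_norm_le ((r : ℂ) * unitVec θ) z
    rw [norm_sub_rev] at this
    linarith
  have hint : ∀ G : ℝ × ℝ → ℂ, Continuous G → (∀ r θ, ‖z‖ + R < |r| → G (r, θ) = 0) →
      IntegrableOn G (Ioi (0 : ℝ) ×ˢ Ioo (-Real.pi) Real.pi) := by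
    intro G hG hG0
    have h4 : IntegrableOn G (Icc 0 (‖z‖ + R) ×ˢ Icc (-Real.pi) Real.pi) :=
      hG.continuousOn.integrableOn_compact (isCompact_Icc.prod isCompact_Icc)
    refine h4.of_forall_sdiff_eq_zero (measurableSet_Ioi.prod measurableSet_Ioo) ?_
    rintro ⟨r, θ⟩ ⟨⟨hr, hθ⟩, hn⟩
    refine hG0 r θ ?_
    by_contra hcon
    simp only [mem_Ioi] at hr
    rw [abs_of_pos hr] at hcon
    exact hn ⟨⟨hr.le, not_lt.1 hcon⟩, ⟨hθ.1.le, hθ.2.le⟩⟩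
  have hAi := hint A hAc (fun r θ h => by simp [hA, hDR _ (hfar r θ h)])
  have hBi := hint B hBc (fun r θ h => by simp [hB, hDR _ (hfar r θ h)])
  have hGd : ∀ r θ : ℝ, HasDerivAt (fun s : ℝ => f (z - s * unitVec θ))
      (-A (r, θ)) r := by
    intro r θ
    have h5 : HasDerivAt (fun s : ℝ => z - s * unitVec θ) (-unitVec θ) r := by
      have := ((hasDerivAt_id r).ofReal_comp.mul_const (unitVec θ)).const_sub z
      simpa using this
    have := (hfd _).hasFDerivAt.comp_hasDerivAt r h5
    rw [map_neg] at this
    exact this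
  have hGd' : ∀ r θ : ℝ, HasDerivAt (fun s : ℝ => f (z - r * unitVec s))
      (-(r * B (r, θ))) θ := by
    intro r θ
    have h5 : HasDerivAt (fun s : ℝ => z - r * unitVec s) (-(r * (Complex.I * unitVec θ))) θ :=
      ((hasDerivAt_unitVec θ).const_mul (r : ℂ)).const_sub z
    have := (hfd _).hasFDerivAt.comp_hasDerivAt θ h5
    have h6 : (r : ℂ) * (Complex.I * unitVec θ) = r • (Complex.I * unitVec θ) := by simp
    rw [map_neg, h6, map_smul] at this
    rw [Complex.real_smul] at this
    exact this
  have hIA : ∫ p in Ioi (0 : ℝ) ×ˢ Ioo (-Real.pi) Real.pi, A p = 2 * Real.pi * f z := by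
    rw [Measure.volume_eq_prod, ← Measure.prod_restrict, integral_prod_symm]
    · have h7 : ∀ θ : ℝ, ∫ r in Ioi (0 : ℝ), A (r, θ) = f z := by
        intro θ
        have h8 : ContDiff ℝ 1 (fun s : ℝ => f (z - s * unitVec θ)) := by
          refine (hf.of_le (by simp)).comp ?_
          exact contDiff_const.sub (Complex.ofRealCLM.contDiff.mul contDiff_const)
        have h9 : HasCompactSupport (fun s : ℝ => f (z - s * unitVec θ)) := by
          refine HasCompactSupport.intro (isCompact_Icc (a := -(‖z‖ + R)) (b := ‖z‖ + R))
            fun s hs => hR _ (hfar s θ ?_)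
          by_contra hcon
          exact hs (abs_le.1 (not_lt.1 hcon))
        have := h9.integral_Ioi_deriv_eq h8 0
        have h10 : deriv (fun s : ℝ => f (z - s * unitVec θ)) = fun r => -A (r, θ) := by
          ext r
          exact (hGd r θ).deriv
        rw [h10, integral_neg, neg_inj] at this
        simpa using this
      simp_rw [h7]
      rw [setIntegral_const]
      have : (volume : Measure ℝ).real (Ioo (-Real.pi) Real.pi) = 2 * Real.pi := by
        rw [Real.volume_real_Ioo_of_le (by linarith [Real.pi_pos])]
        ring
      rw [this]
      simp
    · rw [Measure.prod_restrict]; exact hAi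
  have hIB : ∫ p in Ioi (0 : ℝ) ×ˢ Ioo (-Real.pi) Real.pi, B p = 0 := by
    rw [Measure.volume_eq_prod, setIntegral_prod _ hBi]
    refine setIntegral_eq_zero_of_forall_eq_zero fun r hr => ?_
    rw [← integral_Ioc_eq_integral_Ioo, ← intervalIntegral.integral_of_le
      (by linarith [Real.pi_pos])]
    have h7 := intervalIntegral.integral_eq_sub_of_hasDerivAt (a := -Real.pi) (b := Real.pi)
      (fun θ _ => hGd' r θ) (Continuous.intervalIntegrable (by fun_prop) _ _)
    have h8 : unitVec Real.pi = unitVec (-Real.pi) := by simp [unitVec]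
    rw [h8, sub_self, intervalIntegral.integral_neg, intervalIntegral.integral_const_mul] at h7
    have hr0 : (r : ℂ) ≠ 0 := by exact_mod_cast (ne_of_gt hr)
    simpa [hr0] using h7
  have hcongr : ∫ p in Ioi (0 : ℝ) ×ˢ Ioo (-Real.pi) Real.pi,
      p.1 • (dzbar f (z - Complex.polarCoord.symm p) / Complex.polarCoord.symm p) =
      ∫ p in Ioi (0 : ℝ) ×ˢ Ioo (-Real.pi) Real.pi,
        ((1 / 2 : ℂ) * A p + (Complex.I / 2) * B p) := by
    refine setIntegral_congr_fun (measurableSet_Ioi.prod measurableSet_Ioo) ?_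
    rintro ⟨r, θ⟩ ⟨hr, -⟩
    have hr0 : (r : ℂ) ≠ 0 := by exact_mod_cast (ne_of_gt hr)
    have hP : Complex.polarCoord.symm (r, θ) = r * unitVec θ := by
      rw [Complex.polarCoord_symm_apply, unitVec]
    simp only [hP, hA, hB]
    rw [← div_div, div_right_comm, dzbar_div_unitVec, Complex.real_smul]
    field_simp
  rw [hcongr, integral_add (hAi.const_mul _) (hBi.const_mul _), integral_const_mul,
    integral_const_mul, hIA, hIB]
  have : (Real.pi : ℂ) ≠ 0 := by exact_mod_cast Real.pi_ne_zero
  field_simp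
  simp

end Pompeiu

/-! ### Decay of the Cauchy transform -/

section Decay

/-- The constant depends on the radius of the support alone, so the bound is uniform in `n` and `ε`
later. On the support `|z| ≤ |z - w| + R`, which trades the growth factor `1 + |z|` for the kernel
and a constant. -/
theorem exists_cauchy_bound {R : ℝ} (hR0 : 0 ≤ R) : ∃ K : ℝ, 0 ≤ K ∧
    ∀ (f : ℂ → ℂ) (M : ℝ), 0 ≤ M → (∀ w, ‖f w‖ ≤ M) → (∀ w, R < ‖w‖ → f w = 0) →
    ∀ z, ‖cauchy f z‖ ≤ K * M * (1 + ‖z‖)⁻¹ := by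
  set κ : ℂ → ℝ := (Metric.ball (0 : ℂ) 1).indicator fun w => ‖w‖⁻¹ with hκ
  have hκi : Integrable κ := by
    rw [hκ, integrable_indicator_iff measurableSet_ball]
    simpa using! integrableOn_inv_ball.norm
  have hκ0 : ∀ w, 0 ≤ κ w := fun w => indicator_nonneg (fun _ _ => by positivity) _
  set χ : ℂ → ℝ := (Metric.closedBall (0 : ℂ) R).indicator fun _ => 1 with hχ
  have hχi : Integrable χ := by
    rw [hχ, integrable_indicator_iff measurableSet_closedBall]
    exact integrableOn_const (measure_closedBall_lt_top.ne)
  have hχ0 : ∀ w, 0 ≤ χ w := fun w => indicator_nonneg (fun _ _ => by positivity) _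
  -- From `(1 + |z|)/|z - w| ≤ (1 + R)/|z - w| + 1` and `1/|z - w| ≤ 1 + κ (z - w)`, integrated over
  -- the disc.
  set J : ℝ := (2 + R) * (∫ w, χ w) + (1 + R) * ∫ w, κ w with hJ
  have hJ0 : 0 ≤ J := add_nonneg (mul_nonneg (by linarith) (integral_nonneg hχ0))
    (mul_nonneg (by linarith) (integral_nonneg hκ0))
  refine ⟨‖(1 / (Real.pi : ℂ))‖ * J, by positivity, fun f M hM hfM hf0 z => ?_⟩
  have hz : 0 < 1 + ‖z‖ := by positivity
  have hb : ∀ w, ‖f w / (z - w)‖ ≤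
      M * (1 + ‖z‖)⁻¹ * ((2 + R) * χ w + (1 + R) * κ (z - w)) := by
    intro w
    have hnn : 0 ≤ (2 + R) * χ w + (1 + R) * κ (z - w) :=
      add_nonneg (mul_nonneg (by linarith) (hχ0 _)) (mul_nonneg (by linarith) (hκ0 _))
    by_cases hw : R < ‖w‖
    · rw [hf0 w hw]
      simp only [zero_div, norm_zero]
      positivity
    have hχw : χ w = 1 := by
      rw [hχ, indicator_of_mem]
      simpa using not_lt.1 hw
    rw [norm_div]
    have key : ‖z - w‖⁻¹ ≤ (1 + ‖z‖)⁻¹ * ((2 + R) * χ w + (1 + R) * κ (z - w)) := by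
      rw [inv_mul_eq_div, le_div_iff₀ hz, hχw]
      rcases eq_or_ne (z - w) 0 with h0 | h0
      · have := hκ0 (z - w)
        rw [h0, norm_zero, inv_zero, zero_mul]
        rw [h0] at this
        nlinarith
      have ht : 0 < ‖z - w‖ := norm_pos_iff.2 h0
      have h1 : ‖z - w‖⁻¹ ≤ 1 + κ (z - w) := by
        by_cases h2 : ‖z - w‖ < 1
        · have : κ (z - w) = ‖z - w‖⁻¹ := by
            rw [hκ, indicator_of_mem (by simpa using h2)]
          linarith
        · have := inv_le_one_of_one_le₀ (not_lt.1 h2)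
          linarith [hκ0 (z - w)]
      have h3 : ‖z‖ ≤ ‖z - w‖ + R := by
        have := norm_add_le (z - w) w
        simp only [sub_add_cancel] at this
        linarith [not_lt.1 hw]
      have h4 : ‖z - w‖⁻¹ * (1 + ‖z‖) ≤ ‖z - w‖⁻¹ * ((1 + R) + ‖z - w‖) :=
        mul_le_mul_of_nonneg_left (by linarith) (by positivity)
      rw [mul_add _ (1 + R), inv_mul_cancel₀ ht.ne'] at h4
      nlinarith
    calc ‖f w‖ / ‖z - w‖ ≤ M * ‖z - w‖⁻¹ := by
          rw [div_eq_mul_inv]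
          gcongr
          exact hfM w
      _ ≤ M * ((1 + ‖z‖)⁻¹ * ((2 + R) * χ w + (1 + R) * κ (z - w))) := by gcongr
      _ = _ := by ring
  have hκz : Integrable fun w => κ (z - w) := hκi.comp_sub_left z
  have h5 := norm_integral_le_of_norm_le
    (((hχi.const_mul (2 + R)).add (hκz.const_mul (1 + R))).const_mul (M * (1 + ‖z‖)⁻¹))
    (Eventually.of_forall hb)
  simp only [Pi.add_apply] at h5
  rw [integral_const_mul, integral_add (hχi.const_mul _) (hκz.const_mul _), integral_const_mul,
    integral_const_mul, integral_sub_left_eq_self κ volume z] at h5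
  rw [cauchy, norm_mul]
  calc _ ≤ ‖(1 / (Real.pi : ℂ))‖ * (M * (1 + ‖z‖)⁻¹ * J) := by gcongr
    _ = _ := by ring

variable {f : ℂ → ℂ}

theorem exists_cauchy_decay (hf : Continuous f) (hs : HasCompactSupport f) :
    ∃ C : ℝ, 0 ≤ C ∧ ∀ z, ‖cauchy f z‖ ≤ C * (1 + ‖z‖)⁻¹ := by
  obtain ⟨R, hR0, hR⟩ := exists_radius hs
  obtain ⟨K, hK0, hK⟩ := exists_cauchy_bound hR0
  obtain ⟨M, hM⟩ := hf.bounded_above_of_compact_support hs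
  have hM0 : 0 ≤ M := (norm_nonneg _).trans (hM 0)
  exact ⟨K * M, by positivity, hK f M hM0 hM hR⟩

/-- Since `z / (z - w) = 1 + w / (z - w)`, a function of mean zero satisfies `z 𝒞f = 𝒞(w f)`, and
the right side already decays like `(1 + |z|)⁻¹`. -/
theorem exists_cauchy_decay_sq (hf : Continuous f) (hs : HasCompactSupport f)
    (h0 : ∫ w, f w = 0) :
    ∃ C : ℝ, 0 ≤ C ∧ ∀ z, ‖cauchy f z‖ ≤ C * (1 + ‖z‖)⁻¹ ^ 2 := by
  have hwc : Continuous fun w => w * f w := by fun_prop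
  have hws : HasCompactSupport fun w => w * f w := hs.mul_left
  obtain ⟨C₁, h₁, hC₁⟩ := exists_cauchy_decay hf hs
  obtain ⟨C₂, h₂, hC₂⟩ := exists_cauchy_decay hwc hws
  refine ⟨C₁ + C₂, by positivity, fun z => ?_⟩
  have hzc : z * cauchy f z = cauchy (fun w => w * f w) z := by
    have h3 : ∫ w, z * (f w / (z - w)) = ∫ w, (f w + w * f w / (z - w)) := by
      refine integral_congr_ae ?_
      have : ∀ᵐ w : ℂ, w ≠ z := by simp [ae_iff]
      filter_upwards [this] with w hw
      have : z - w ≠ 0 := sub_ne_zero.2 hw.symm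
      field_simp
      ring
    rw [integral_add (hf.integrable_of_hasCompactSupport hs)
      (integrable_cauchy_integrand hwc hws z), h0, zero_add, integral_const_mul] at h3
    rw [cauchy, cauchy, ← h3]
    ring
  have h4 : ‖z‖ * ‖cauchy f z‖ ≤ C₂ * (1 + ‖z‖)⁻¹ := by
    rw [← norm_mul, hzc]
    exact hC₂ z
  have hz : 0 < 1 + ‖z‖ := by positivity
  have h5 : (1 + ‖z‖) * ‖cauchy f z‖ ≤ (C₁ + C₂) * (1 + ‖z‖)⁻¹ := by
    linarith [hC₁ z]
  calc ‖cauchy f z‖ = (1 + ‖z‖)⁻¹ * ((1 + ‖z‖) * ‖cauchy f z‖) := by field_simp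
    _ ≤ (1 + ‖z‖)⁻¹ * ((C₁ + C₂) * (1 + ‖z‖)⁻¹) := by gcongr
    _ = _ := by ring

theorem tendsto_inv_one_add_norm :
    Tendsto (fun z : ℂ => (1 + ‖z‖)⁻¹) (cocompact ℂ) (𝓝 0) :=
  tendsto_inv_atTop_zero.comp
    (tendsto_atTop_add_const_left _ _ (tendsto_norm_cocompact_atTop))

theorem tendsto_of_decay {g : ℂ → ℂ} {C : ℝ} (h : ∀ z, ‖g z‖ ≤ C * (1 + ‖z‖)⁻¹) :
    Tendsto g (cocompact ℂ) (𝓝 0) := by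
  refine squeeze_zero_norm h ?_
  simpa using tendsto_inv_one_add_norm.const_mul C

theorem integrable_of_decay {g : ℂ → ℂ} {C : ℝ} (hg : Continuous g)
    (h : ∀ z, ‖g z‖ ≤ C * (1 + ‖z‖)⁻¹ ^ 3) : Integrable g := by
  have hi := (integrable_one_add_norm (E := ℂ) (μ := volume) (r := 3)
    (by rw [Complex.finrank_real_complex]; norm_num)).const_mul C
  refine hi.mono' hg.aestronglyMeasurable (Eventually.of_forall fun z => (h z).trans_eq ?_)
  rw [Real.rpow_neg (by positivity), inv_pow]
  norm_cast

/-- **Liouville's theorem** in the form of uniqueness for the `∂_{z̄}`-equation. -/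
theorem eq_cauchy_of_tendsto {r : ℂ → ℂ} (hr : ContDiff ℝ ∞ r)
    (h0 : Tendsto r (cocompact ℂ) (𝓝 0)) (hf : ContDiff ℝ ∞ f) (hs : HasCompactSupport f)
    (hd : ∀ z, dzbar r z = f z) : r = cauchy f := by
  obtain ⟨C, -, hC⟩ := exists_cauchy_decay hf.continuous hs
  have hcs := contDiff_cauchy hf hs
  have hrd : Differentiable ℝ r := hr.differentiable (by simp)
  have hcd : Differentiable ℝ (cauchy f) := hcs.differentiable (by simp)
  have hdiff : Differentiable ℂ (fun z => r z - cauchy f z) := by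
    intro z
    rw [differentiableAt_complex_iff_differentiableAt_real]
    refine ⟨(hrd z).sub (hcd z), ?_⟩
    have h1 : dzbar r z = dzbar (cauchy f) z := by rw [hd, dzbar_cauchy hf hs]
    have h2 := fderiv_fun_sub (hrd z) (hcd z)
    rw [h2]
    simp only [sub_apply, smul_eq_mul]
    rw [dzbar, dzbar] at h1
    -- Equal `∂_{z̄}` derivatives amount to the Cauchy–Riemann equation for the difference, which is
    -- therefore entire and tends to zero at infinity.
    linear_combination (-2 * Complex.I) * h1 + (fderiv ℝ r z Complex.I -
      fderiv ℝ (cauchy f) z Complex.I) * Complex.I_mul_I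
  have ht : Tendsto (fun z => r z - cauchy f z) (cocompact ℂ) (𝓝 0) := by
    simpa using h0.sub (tendsto_of_decay hC)
  ext z
  exact sub_eq_zero.1 (hdiff.apply_eq_of_tendsto_cocompact z ht)

end Decay

/-! ### The Beltrami transform is an isometry of `L²` -/

section Isometry

theorem fderiv_apply_comm {E : Type*} [NormedAddCommGroup E] [NormedSpace ℝ E] {F : E → ℂ}
    (hF : ContDiff ℝ ∞ F) (p e e' : E) :
    fderiv ℝ (fun q => fderiv ℝ F q e) p e' = fderiv ℝ (fun q => fderiv ℝ F q e') p e := by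
  have hd : DifferentiableAt ℝ (fderiv ℝ F) p :=
    ((hF.fderiv_right (m := ∞) (by simp)).differentiable (by simp)) p
  have h1 : ∀ e e', fderiv ℝ (fun q => fderiv ℝ F q e) p e' = fderiv ℝ (fderiv ℝ F) p e' e := by
    intro e e'
    rw [fderiv_clm_apply hd (differentiableAt_const _)]
    simp
  rw [h1, h1]
  exact (hF.contDiffAt.isSymmSndFDerivAt
    (by rw [minSmoothness_of_isRCLikeNormedField]; exact ENat.LEInfty.out)) e' e

theorem contDiff_fderiv_apply {E : Type*} [NormedAddCommGroup E] [NormedSpace ℝ E] {F : E → ℂ}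
    (hF : ContDiff ℝ ∞ F) (e : E) : ContDiff ℝ ∞ (fun q => fderiv ℝ F q e) :=
  (hF.fderiv_right (m := ∞) (by simp)).clm_apply contDiff_const

variable {f : ℂ → ℂ}

theorem integral_fderiv_eq_zero (hf : ContDiff ℝ ∞ f) (hs : HasCompactSupport f) (e : ℂ) :
    ∫ w, fderiv ℝ f w e = 0 := by
  have hi : Integrable (fun w => fderiv ℝ f w e) :=
    (contDiff_fderiv_apply hf e).continuous.integrable_of_hasCompactSupport (hs.fderiv_apply ℝ e)
  have := integral_mul_fderiv_eq_neg_fderiv_mul_of_integrable (μ := (volume : Measure ℂ))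
    (f := fun _ : ℂ => (1 : ℂ)) (g := f) (v := e) (by simp) (by simpa using hi)
    (by simpa using hf.continuous.integrable_of_hasCompactSupport hs)
    (fun _ _ => differentiableAt_const _) (fun x _ => (hf.differentiable (by simp)) x)
  simpa using this

theorem fderiv_conj {u : ℂ → ℂ} {z : ℂ} (hu : DifferentiableAt ℝ u z) (e : ℂ) :
    fderiv ℝ (fun w => starRingEnd ℂ (u w)) z e = starRingEnd ℂ (fderiv ℝ u z e) := by
  have h := (Complex.conjCLE.toContinuousLinearMap.hasFDerivAt (x := u z)).comp z hu.hasFDerivAt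
  have h2 : HasFDerivAt (fun w => starRingEnd ℂ (u w))
    (Complex.conjCLE.toContinuousLinearMap.comp (fderiv ℝ u z)) z := h
  rw [h2.fderiv]
  rfl

/-- With `u = 𝒞 f`, `|∂_z u|²` and `|∂_{z̄} u|²` differ only by a multiple of `u_x conj(u_y) - u_y
conj(u_x)`. Integrating by parts and commuting second derivatives shows that this cross term has
integral zero; and `∂_{z̄} u = f`. -/
theorem integral_norm_beltrami_sq (hf : ContDiff ℝ ∞ f) (hs : HasCompactSupport f) :
    Integrable (fun z => ‖beltrami f z‖ ^ 2) ∧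
      ∫ z, ‖beltrami f z‖ ^ 2 = ∫ z, ‖f z‖ ^ 2 := by
  set u := cauchy f with hu
  have hus : ContDiff ℝ ∞ u := contDiff_cauchy hf hs
  have hud : Differentiable ℝ u := hus.differentiable (by simp)
  have hfe : ∀ e, ContDiff ℝ ∞ fun w => fderiv ℝ f w e := contDiff_fderiv_apply hf
  have hse : ∀ e, HasCompactSupport fun w => fderiv ℝ f w e := fun e => hs.fderiv_apply ℝ e
  have hue : ∀ e, ContDiff ℝ ∞ fun w => fderiv ℝ u w e := contDiff_fderiv_apply hus
  have hued : ∀ e, Differentiable ℝ fun w => fderiv ℝ u w e := fun e =>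
    (hue e).differentiable (by simp)
  have h1 : ∀ e, (fun w => fderiv ℝ u w e) = cauchy fun w => fderiv ℝ f w e := fun e => by
    ext z; exact fderiv_cauchy hf hs z e
  obtain ⟨C₀, h₀, hC₀⟩ := exists_cauchy_decay hf.continuous hs
  -- Derivatives of `f` have mean zero, so derivatives of `u` gain a power of decay. This makes all
  -- the products below integrable on the plane without boundary terms.
  have hd1 : ∀ e, ∃ C : ℝ, 0 ≤ C ∧ ∀ z, ‖fderiv ℝ u z e‖ ≤ C * (1 + ‖z‖)⁻¹ ^ 2 := by
    intro e
    have h := exists_cauchy_decay_sq (hfe e).continuous (hse e) (integral_fderiv_eq_zero hf hs e)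
    rw [← h1] at h
    exact h
  have hd2 : ∀ e e', ∃ C : ℝ, 0 ≤ C ∧
      ∀ z, ‖fderiv ℝ (fun w => fderiv ℝ u w e) z e'‖ ≤ C * (1 + ‖z‖)⁻¹ ^ 2 := by
    intro e e'
    obtain ⟨C, hC0, hC⟩ := exists_cauchy_decay_sq (contDiff_fderiv_apply (hfe e) e').continuous
      ((hse e).fderiv_apply ℝ e') (integral_fderiv_eq_zero (hfe e) (hse e) e')
    refine ⟨C, hC0, fun z => ?_⟩
    rw [h1, fderiv_cauchy (hfe e) (hse e)]
    exact hC z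
  have hle : ∀ z : ℂ, (1 + ‖z‖)⁻¹ ≤ 1 := fun z =>
    inv_le_one_of_one_le₀ (by linarith [norm_nonneg z])
  have hpos : ∀ z : ℂ, 0 ≤ (1 + ‖z‖)⁻¹ := fun z => by positivity
  have hint4 : ∀ e e', Integrable fun z => fderiv ℝ u z e * starRingEnd ℂ (fderiv ℝ u z e') := by
    intro e e'
    obtain ⟨C, hC0, hC⟩ := hd1 e
    obtain ⟨C', hC0', hC'⟩ := hd1 e'
    refine integrable_of_decay (C := C * C')
      ((hue e).continuous.mul (Complex.continuous_conj.comp (hue e').continuous)) fun z => ?_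
    rw [norm_mul, RCLike.norm_conj]
    calc _ ≤ (C * (1 + ‖z‖)⁻¹ ^ 2) * (C' * (1 + ‖z‖)⁻¹ ^ 2) := by
          gcongr
          exacts [hC z, hC' z]
      _ = C * C' * (1 + ‖z‖)⁻¹ ^ 3 * (1 + ‖z‖)⁻¹ := by ring
      _ ≤ _ := mul_le_of_le_one_right (by have := hpos z; positivity) (hle z)
  have hint3 : ∀ g : ℂ → ℂ, Continuous g → (∃ C : ℝ, 0 ≤ C ∧
      ∀ z, ‖g z‖ ≤ C * (1 + ‖z‖)⁻¹ ^ 2) → Integrable fun z => u z * starRingEnd ℂ (g z) := by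
    rintro g hg ⟨C, hC0, hC⟩
    refine integrable_of_decay (C := C₀ * C)
      (hus.continuous.mul (Complex.continuous_conj.comp hg)) fun z => ?_
    rw [norm_mul, RCLike.norm_conj]
    calc _ ≤ (C₀ * (1 + ‖z‖)⁻¹) * (C * (1 + ‖z‖)⁻¹ ^ 2) := by
          gcongr
          exacts [hC₀ z, hC z]
      _ = _ := by ring
  have hparts : ∀ e e', ∫ z, fderiv ℝ u z e * starRingEnd ℂ (fderiv ℝ u z e') =
      -∫ z, u z * starRingEnd ℂ (fderiv ℝ (fun w => fderiv ℝ u w e') z e) := by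
    intro e e'
    have h := integral_mul_fderiv_eq_neg_fderiv_mul_of_integrable (μ := (volume : Measure ℂ))
      (f := u) (g := fun z => starRingEnd ℂ (fderiv ℝ u z e')) (v := e) (hint4 e e')
      (by
        simp_rw [fun z => fderiv_conj (hued e' z) e]
        exact hint3 _ (contDiff_fderiv_apply (hue e') e).continuous (hd2 e' e))
      (hint3 _ (hue e').continuous (hd1 e'))
      (fun x _ => hud x)
      (fun x _ => (Complex.conjCLE.differentiableAt).comp x (hued e' x))
    simp_rw [fun z => fderiv_conj (hued e' z) e] at h
    rw [h, neg_neg]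
  have hsymm : ∫ z, fderiv ℝ u z 1 * starRingEnd ℂ (fderiv ℝ u z Complex.I) =
      ∫ z, fderiv ℝ u z Complex.I * starRingEnd ℂ (fderiv ℝ u z 1) := by
    rw [hparts, hparts]
    simp_rw [fun z => fderiv_apply_comm hus z 1 Complex.I]
  have hcast : ∀ c : ℂ, ((‖c‖ ^ 2 : ℝ) : ℂ) = c * starRingEnd ℂ c := fun c => by
    rw [Complex.mul_conj, Complex.normSq_eq_norm_sq]
  have hbe : ∀ z, ((‖beltrami f z‖ ^ 2 : ℝ) : ℂ) = 1 / 4 *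
      ((fderiv ℝ u z 1 * starRingEnd ℂ (fderiv ℝ u z 1) +
        fderiv ℝ u z Complex.I * starRingEnd ℂ (fderiv ℝ u z Complex.I)) + Complex.I *
      (fderiv ℝ u z 1 * starRingEnd ℂ (fderiv ℝ u z Complex.I) -
        fderiv ℝ u z Complex.I * starRingEnd ℂ (fderiv ℝ u z 1))) := by
    intro z
    rw [hcast, beltrami, dz, ← hu]
    simp only [map_div₀, map_sub, map_mul, Complex.conj_I, map_ofNat]
    linear_combination (-1/4 : ℂ) * fderiv ℝ u z Complex.I *
      starRingEnd ℂ (fderiv ℝ u z Complex.I) * Complex.I_mul_I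
  have hfe' : ∀ z, ((‖f z‖ ^ 2 : ℝ) : ℂ) = 1 / 4 *
      ((fderiv ℝ u z 1 * starRingEnd ℂ (fderiv ℝ u z 1) +
        fderiv ℝ u z Complex.I * starRingEnd ℂ (fderiv ℝ u z Complex.I)) - Complex.I *
      (fderiv ℝ u z 1 * starRingEnd ℂ (fderiv ℝ u z Complex.I) -
        fderiv ℝ u z Complex.I * starRingEnd ℂ (fderiv ℝ u z 1))) := by
    intro z
    rw [hcast, ← dzbar_cauchy hf hs z, dzbar, ← hu]
    simp only [map_div₀, map_add, map_mul, Complex.conj_I, map_ofNat]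
    linear_combination (-1/4 : ℂ) * fderiv ℝ u z Complex.I *
      starRingEnd ℂ (fderiv ℝ u z Complex.I) * Complex.I_mul_I
  have hS := (hint4 1 1).add (hint4 Complex.I Complex.I)
  have hT := ((hint4 1 Complex.I).sub (hint4 Complex.I 1)).const_mul Complex.I
  have hbi : Integrable fun z => ((‖beltrami f z‖ ^ 2 : ℝ) : ℂ) := by
    simp_rw [hbe]
    exact (hS.add hT).const_mul _
  refine ⟨hbi.re.congr (Eventually.of_forall fun z => Complex.ofReal_re _), ?_⟩
  have hmain : ∫ z, ((‖beltrami f z‖ ^ 2 : ℝ) : ℂ) = ∫ z, ((‖f z‖ ^ 2 : ℝ) : ℂ) := by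
    have hT0 : ∫ z, Complex.I * (fderiv ℝ u z 1 * starRingEnd ℂ (fderiv ℝ u z Complex.I) -
        fderiv ℝ u z Complex.I * starRingEnd ℂ (fderiv ℝ u z 1)) = 0 := by
      rw [integral_const_mul, integral_sub (hint4 _ _) (hint4 _ _), hsymm, sub_self, mul_zero]
    simp_rw [hbe, hfe']
    rw [integral_const_mul, integral_const_mul]
    congr 1
    refine (integral_add hS hT).trans ((integral_sub hS hT).trans ?_).symm
    simp only [Pi.sub_apply] at hT0 ⊢
    rw [hT0, sub_zero, add_zero]
  rw [integral_complex_ofReal, integral_complex_ofReal] at hmain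
  exact_mod_cast hmain

theorem contDiff_beltrami (hf : ContDiff ℝ ∞ f) (hs : HasCompactSupport f) :
    ContDiff ℝ ∞ (beltrami f) := by
  have h := contDiff_cauchy hf hs
  exact (((contDiff_fderiv_apply h 1).sub
    (contDiff_const.mul (contDiff_fderiv_apply h Complex.I))).div_const 2)

theorem eLpNorm_beltrami (hf : ContDiff ℝ ∞ f) (hs : HasCompactSupport f) :
    eLpNorm (beltrami f) 2 volume = eLpNorm f 2 volume := by
  obtain ⟨hi, he⟩ := integral_norm_beltrami_sq hf hs
  have h1 : MemLp (beltrami f) 2 volume :=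
    (memLp_two_iff_integrable_sq_norm
      (contDiff_beltrami hf hs).continuous.aestronglyMeasurable).2 hi
  have h2 : MemLp f 2 volume := hf.continuous.memLp_of_hasCompactSupport hs
  rw [h1.eLpNorm_eq_integral_rpow_norm (by simp) (by simp),
    h2.eLpNorm_eq_integral_rpow_norm (by simp) (by simp)]
  simp only [ENNReal.toReal_ofNat, Real.rpow_ofNat]
  rw [he]

end Isometry

/-! ### Sequences of functions controlled together with their derivatives -/

/-- The property `P` holds for `F` and for all its iterated directional derivatives of order at
most `k`. -/
def Ders (P : (ℕ → ℂ × ℝ → ℂ) → Prop) : ℕ → (ℕ → ℂ × ℝ → ℂ) → Prop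
  | 0, F => P F
  | k + 1, F => P F ∧ ∀ e, Ders P k (fun n p => fderiv ℝ (F n) p e)

namespace Ders

variable {P Q : (ℕ → ℂ × ℝ → ℂ) → Prop} {F G : ℕ → ℂ × ℝ → ℂ} {k : ℕ}

theorem self (h : Ders P k F) : P F := by
  cases k with
  | zero => exact h
  | succ k => exact h.1

theorem of_succ (h : Ders P (k + 1) F) : Ders P k F := by
  induction k generalizing F with
  | zero => exact h.1
  | succ k ih => exact ⟨h.1, fun e => ih (h.2 e)⟩

theorem mono {m : ℕ} (hm : m ≤ k) (h : Ders P k F) : Ders P m F := by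
  induction k, hm using Nat.le_induction with
  | base => exact h
  | succ k _ ih => exact ih h.of_succ

theorem add (hP : ∀ F, P F → ∀ n, ContDiff ℝ ∞ (F n))
    (hadd : ∀ F G, P F → P G → P fun n p => F n p + G n p)
    (hF : Ders P k F) (hG : Ders P k G) : Ders P k fun n p => F n p + G n p := by
  induction k generalizing F G with
  | zero => exact hadd _ _ hF hG
  | succ k ih =>
    refine ⟨hadd _ _ hF.1 hG.1, fun e => ?_⟩
    have h := ih (hF.2 e) (hG.2 e)
    convert h using 3 with n p
    rw [fderiv_fun_add ((hP F hF.1 n).differentiable (by simp) p)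
      ((hP G hG.1 n).differentiable (by simp) p)]
    rfl

theorem const_mul (hP : ∀ F, P F → ∀ n, ContDiff ℝ ∞ (F n)) (c : ℂ)
    (hmul : ∀ F, P F → P fun n p => c * F n p)
    (hF : Ders P k F) : Ders P k fun n p => c * F n p := by
  induction k generalizing F with
  | zero => exact hmul _ hF
  | succ k ih =>
    refine ⟨hmul _ hF.1, fun e => ?_⟩
    have h := ih (hF.2 e)
    convert h using 3 with n p
    rw [fderiv_const_mul ((hP F hF.1 n).differentiable (by simp) p)]
    rfl

end Ders

/-! ### Partial derivatives as directional derivatives -/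

section Partial

variable {F : ℂ × ℝ → ℂ}

theorem fderiv_slice (hF : Differentiable ℝ F) (z e : ℂ) (ε : ℝ) :
    fderiv ℝ (fun w => F (w, ε)) z e = fderiv ℝ F (z, ε) (e, 0) := by
  have h1 : HasFDerivAt (fun w : ℂ => (w, ε)) (ContinuousLinearMap.inl ℝ ℂ ℝ) z :=
    hasFDerivAt_prodMk_left z ε
  have h := (hF (z, ε)).hasFDerivAt.comp z h1
  have h2 : HasFDerivAt (fun w => F (w, ε))
    ((fderiv ℝ F (z, ε)).comp (ContinuousLinearMap.inl ℝ ℂ ℝ)) z := h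
  rw [h2.fderiv]
  simp

theorem partialZ_eq (hF : Differentiable ℝ F) : partialZ F = fun p =>
    (1 / 2 : ℂ) * fderiv ℝ F p (1, 0) + (-Complex.I / 2) * fderiv ℝ F p (Complex.I, 0) := by
  ext ⟨z, ε⟩
  rw [partialZ, dz, fderiv_slice hF, fderiv_slice hF]
  ring

theorem partialZbar_eq (hF : Differentiable ℝ F) : partialZbar F = fun p =>
    (1 / 2 : ℂ) * fderiv ℝ F p (1, 0) + (Complex.I / 2) * fderiv ℝ F p (Complex.I, 0) := by
  ext ⟨z, ε⟩
  rw [partialZbar, dzbar, fderiv_slice hF, fderiv_slice hF]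
  ring

theorem partialEps_eq (hF : Differentiable ℝ F) :
    partialEps F = fun p => fderiv ℝ F p (0, 1) := by
  ext ⟨z, ε⟩
  have h1 : HasFDerivAt (fun t : ℝ => (z, t)) (ContinuousLinearMap.inr ℝ ℂ ℝ) ε :=
    hasFDerivAt_prodMk_right z ε
  have h := (hF (z, ε)).hasFDerivAt.comp ε h1
  have h2 : HasFDerivAt (fun t => F (z, t))
    ((fderiv ℝ F (z, ε)).comp (ContinuousLinearMap.inr ℝ ℂ ℝ)) ε := h
  rw [partialEps, h2.hasDerivAt.deriv]
  simp

theorem contDiff_partialZ (hF : ContDiff ℝ ∞ F) : ContDiff ℝ ∞ (partialZ F) := by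
  rw [partialZ_eq (hF.differentiable (by simp))]
  exact (contDiff_const.mul (contDiff_fderiv_apply hF _)).add
    (contDiff_const.mul (contDiff_fderiv_apply hF _))

theorem fderiv_partialZ (hF : ContDiff ℝ ∞ F) (p e : ℂ × ℝ) :
    fderiv ℝ (partialZ F) p e = partialZ (fun q => fderiv ℝ F q e) p := by
  have hd : ∀ e, Differentiable ℝ fun q => fderiv ℝ F q e := fun e =>
    (contDiff_fderiv_apply hF e).differentiable (by simp)
  rw [partialZ_eq (hF.differentiable (by simp)), partialZ_eq (hd e),
    fderiv_fun_add ((hd _).const_mul _ p) ((hd _).const_mul _ p), fderiv_const_mul (hd _ p),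
    fderiv_const_mul (hd _ p)]
  simp [fderiv_apply_comm hF p _ e]

theorem fderiv_eq_zero_of_supported {R : ℝ} (hR : ∀ p, R < ‖p‖ → F p = 0) {p : ℂ × ℝ}
    (hp : R < ‖p‖) (e : ℂ × ℝ) : fderiv ℝ F p e = 0 := by
  have : F =ᶠ[𝓝 p] fun _ => 0 := by
    have ho : IsOpen {q : ℂ × ℝ | R < ‖q‖} := isOpen_lt (by fun_prop) (by fun_prop)
    filter_upwards [ho.mem_nhds hp] with q hq
    exact hR _ hq
  rw [this.fderiv_eq]
  simp

theorem hasCompactSupport_of_supported {R : ℝ} (hR : ∀ p, R < ‖p‖ → F p = 0) :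
    HasCompactSupport F :=
  HasCompactSupport.intro (isCompact_closedBall 0 R) fun p hp => hR p (by simpa using hp)

theorem exists_radius_param (hF : HasCompactSupport F) :
    ∃ R : ℝ, 0 ≤ R ∧ ∀ p, R < ‖p‖ → F p = 0 := by
  obtain ⟨R, hR⟩ := hF.isCompact.isBounded.subset_closedBall 0
  refine ⟨max R 0, le_max_right _ _, fun z hz => ?_⟩
  by_contra h
  have := hR (subset_tsupport F h)
  simp only [Metric.mem_closedBall, dist_zero_right] at this
  exact absurd (lt_of_le_of_lt (le_max_left R 0) hz) (not_lt.2 this)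

theorem slice_eq_zero {R : ℝ} (hR : ∀ p, R < ‖p‖ → F p = 0) (ε : ℝ) (w : ℂ) (hw : R < ‖w‖) :
    F (w, ε) = 0 :=
  hR _ (hw.trans_le (norm_fst_le (w, ε)))

theorem hasCompactSupport_slice {R : ℝ} (hR : ∀ p, R < ‖p‖ → F p = 0) (ε : ℝ) :
    HasCompactSupport fun w => F (w, ε) :=
  HasCompactSupport.intro (isCompact_closedBall 0 R) fun w hw =>
    slice_eq_zero hR ε w (by simpa using hw)

theorem contDiff_slice (hF : ContDiff ℝ ∞ F) (ε : ℝ) : ContDiff ℝ ∞ fun w => F (w, ε) :=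
  hF.comp (contDiff_id.prodMk contDiff_const)

end Partial

/-! ### The Beltrami transform with a parameter -/

/-- The Beltrami transform in `z` at fixed `ε`. -/
noncomputable def beltramiParam (F : ℂ × ℝ → ℂ) : ℂ × ℝ → ℂ := partialZ (cauchyParam F)

section BeltramiParam

variable {F : ℂ × ℝ → ℂ} {R : ℝ}

theorem beltramiParam_apply (F : ℂ × ℝ → ℂ) (z : ℂ) (ε : ℝ) :
    beltramiParam F (z, ε) = beltrami (fun w => F (w, ε)) z := rfl

theorem contDiff_beltramiParam (hF : ContDiff ℝ ∞ F) (hR : ∀ p, R < ‖p‖ → F p = 0) :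
    ContDiff ℝ ∞ (beltramiParam F) :=
  contDiff_partialZ (contDiff_cauchyParam hF fun p hp => hR p (hp.trans_le (norm_fst_le p)))

theorem fderiv_beltramiParam (hF : ContDiff ℝ ∞ F) (hR : ∀ p, R < ‖p‖ → F p = 0)
    (p e : ℂ × ℝ) :
    fderiv ℝ (beltramiParam F) p e = beltramiParam (fun q => fderiv ℝ F q e) p := by
  have hR' : ∀ p : ℂ × ℝ, R < ‖p.1‖ → F p = 0 := fun p hp => hR p (hp.trans_le (norm_fst_le p))
  rw [beltramiParam, fderiv_partialZ (contDiff_cauchyParam hF hR'), beltramiParam]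
  congr 1
  ext q
  exact fderiv_cauchyParam hF hR' q e

end BeltramiParam

/-! ### Geometric decay in `L²` -/

/-- The functions `F n` are smooth, supported in the ball of radius `R`, and their slices at fixed
`ε` decay geometrically in `L²`, uniformly in `ε`. -/
structure GeomL2 (R : ℝ) (F : ℕ → ℂ × ℝ → ℂ) : Prop where
  smooth : ∀ n, ContDiff ℝ ∞ (F n)
  supp : ∀ n p, R < ‖p‖ → F n p = 0
  bound : ∃ C q : ℝ, 0 ≤ C ∧ 0 ≤ q ∧ q < 1 ∧ ∀ n ε,
    eLpNorm (fun z => F n (z, ε)) 2 volume ≤ ENNReal.ofReal (C * q ^ n)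

section GeomL2

variable {R : ℝ} {F G : ℕ → ℂ × ℝ → ℂ}

theorem geom_add_le {C C' q q' : ℝ} (hC : 0 ≤ C) (hC' : 0 ≤ C') (hq : 0 ≤ q) (hq' : 0 ≤ q')
    (n : ℕ) : C * q ^ n + C' * q' ^ n ≤ (C + C') * max q q' ^ n := by
  rw [add_mul]
  gcongr
  · exact le_max_left _ _
  · exact le_max_right _ _

theorem GeomL2.add (hF : GeomL2 R F) (hG : GeomL2 R G) :
    GeomL2 R fun n p => F n p + G n p := by
  obtain ⟨C, q, hC, hq, hq1, h⟩ := hF.bound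
  obtain ⟨C', q', hC', hq', hq1', h'⟩ := hG.bound
  refine ⟨fun n => (hF.smooth n).add (hG.smooth n),
    fun n p hp => by rw [hF.supp n p hp, hG.supp n p hp, add_zero],
    C + C', max q q', by positivity, le_max_of_le_left hq, max_lt hq1 hq1', fun n ε => ?_⟩
  calc eLpNorm (fun z => F n (z, ε) + G n (z, ε)) 2 volume
      ≤ eLpNorm (fun z => F n (z, ε)) 2 volume + eLpNorm (fun z => G n (z, ε)) 2 volume :=
        eLpNorm_add_le (contDiff_slice (hF.smooth n) ε).continuous.aestronglyMeasurable
          (contDiff_slice (hG.smooth n) ε).continuous.aestronglyMeasurable (by norm_num)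
    _ ≤ ENNReal.ofReal (C * q ^ n) + ENNReal.ofReal (C' * q' ^ n) := add_le_add (h n ε) (h' n ε)
    _ = ENNReal.ofReal (C * q ^ n + C' * q' ^ n) :=
        (ENNReal.ofReal_add (by positivity) (by positivity)).symm
    _ ≤ _ := ENNReal.ofReal_le_ofReal (geom_add_le hC hC' hq hq' n)

theorem eLpNorm_mul_beltrami_le {f : ℂ → ℂ} {a : ℂ → ℂ} {M : ℝ} (hf : ContDiff ℝ ∞ f)
    (hs : HasCompactSupport f) (ha : ∀ z, ‖a z‖ ≤ M) :
    eLpNorm (fun z => a z * beltrami f z) 2 volume ≤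
      ENNReal.ofReal M * eLpNorm f 2 volume := by
  rw [← eLpNorm_beltrami hf hs]
  refine eLpNorm_le_mul_eLpNorm_of_ae_le_mul (Eventually.of_forall fun z => ?_) 2
  rw [norm_mul]
  gcongr
  exact ha z

theorem GeomL2.mul_beltrami {a : ℂ × ℝ → ℂ} (ha : ContDiff ℝ ∞ a)
    (haR : ∀ p, R < ‖p‖ → a p = 0) (hF : GeomL2 R F) :
    GeomL2 R fun n p => a p * beltramiParam (F n) p := by
  obtain ⟨C, q, hC, hq, hq1, h⟩ := hF.bound
  obtain ⟨M, hM⟩ := ha.continuous.bounded_above_of_compact_support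
    (hasCompactSupport_of_supported haR)
  have hM0 : 0 ≤ M := (norm_nonneg _).trans (hM 0)
  refine ⟨fun n => ha.mul (contDiff_beltramiParam (hF.smooth n) (hF.supp n)),
    fun n p hp => by rw [haR p hp, zero_mul], M * C, q, by positivity, hq, hq1, fun n ε => ?_⟩
  refine (eLpNorm_mul_beltrami_le (contDiff_slice (hF.smooth n) ε)
    (hasCompactSupport_slice (hF.supp n) ε) (fun z => hM (z, ε))).trans ?_
  rw [mul_assoc, ENNReal.ofReal_mul hM0]
  gcongr
  exact h n ε

/-- Leibniz: the derivative of `a ℬF` is `(∂a) ℬF + a ℬ(∂F)`, since `ℬ` commutes with derivatives.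
Both terms have the same form with one order less, so the induction runs over all `a` and `F`. -/
theorem Ders.mul_beltrami {k : ℕ} {a : ℂ × ℝ → ℂ} (ha : ContDiff ℝ ∞ a)
    (haR : ∀ p, R < ‖p‖ → a p = 0) (hF : Ders (GeomL2 R) k F) :
    Ders (GeomL2 R) k fun n p => a p * beltramiParam (F n) p := by
  induction k generalizing F a with
  | zero => exact GeomL2.mul_beltrami ha haR hF
  | succ k ih =>
    refine ⟨hF.1.mul_beltrami ha haR, fun e => ?_⟩
    have h1 := ih (contDiff_fderiv_apply ha e)
      (fun p hp => fderiv_eq_zero_of_supported haR hp e) hF.of_succ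
    have h2 := ih ha haR (hF.2 e)
    convert h1.add (fun _ h => h.smooth) (fun _ _ => GeomL2.add) h2 using 3 with n p
    have hB := contDiff_beltramiParam (hF.1.smooth n) (hF.1.supp n)
    rw [fderiv_fun_mul (ha.differentiable (by simp) p) (hB.differentiable (by simp) p)]
    simp only [add_apply, smul_apply, smul_eq_mul]
    rw [fderiv_beltramiParam (hF.1.smooth n) (hF.1.supp n)]
    ring

theorem exists_eLpNorm_slice_le {f : ℂ × ℝ → ℂ} (hf : Continuous f)
    (hR : ∀ p, R < ‖p‖ → f p = 0) :
    ∃ X : ℝ, 0 ≤ X ∧ ∀ ε, eLpNorm (fun z => f (z, ε)) 2 volume ≤ ENNReal.ofReal X := by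
  obtain ⟨M, hM⟩ := hf.bounded_above_of_compact_support (hasCompactSupport_of_supported hR)
  set B := volume (Metric.closedBall (0 : ℂ) R) ^ (2 : ENNReal).toReal⁻¹ * ENNReal.ofReal M with hB
  have hBt : B ≠ ⊤ := ENNReal.mul_ne_top
    (ENNReal.rpow_ne_top_of_nonneg (by simp) measure_closedBall_lt_top.ne) ENNReal.ofReal_ne_top
  refine ⟨B.toReal, ENNReal.toReal_nonneg, fun ε => ?_⟩
  rw [ENNReal.ofReal_toReal hBt, ← eLpNorm_restrict_eq_of_support_subset
    (s := Metric.closedBall (0 : ℂ) R)]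
  · refine (eLpNorm_le_of_ae_bound (C := M) (Eventually.of_forall fun z => hM _)).trans_eq ?_
    rw [Measure.restrict_apply_univ]
  · intro z hz
    by_contra h
    exact hz (slice_eq_zero hR ε z (by simpa using h))

variable {μ : ℂ × ℝ → ℂ} {k : ℝ}

/-- The slice norms satisfy `x_{n+1} ≤ k x_n + C qⁿ`, because `ℬ` is isometric and `|μ| ≤ k`. -/
theorem GeomL2.of_recursion (hk0 : 0 ≤ k) (hk1 : k < 1)
    (hk : ∀ p, ‖μ p‖ ≤ k) (hF : ∀ n, ContDiff ℝ ∞ (F n)) (hFR : ∀ n p, R < ‖p‖ → F n p = 0)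
    (hrec : ∀ n p, F (n + 1) p = μ p * beltramiParam (F n) p + G n p) (hG : GeomL2 R G) :
    GeomL2 R F := by
  obtain ⟨C, q, hC, hq, hq1, h⟩ := hG.bound
  obtain ⟨X, hX0, hX⟩ := exists_eLpNorm_slice_le (hF 0).continuous (hFR 0)
  -- The ratio must exceed `k` strictly: for `q = k` the recursion can produce `n kⁿ`. The constant
  -- `A` below dominates the initial norm and satisfies `C ≤ A (r - k)`, so that `k A + C ≤ r A`
  -- closes the induction.
  set r : ℝ := (1 + max k q) / 2 with hr
  have hmax : max k q < 1 := max_lt hk1 hq1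
  have hkr : k < r := by linarith [le_max_left k q]
  have hqr : q ≤ r := by linarith [le_max_right k q]
  have hr1 : r < 1 := by linarith
  have hr0 : 0 ≤ r := hk0.trans hkr.le
  set A : ℝ := X + C / (r - k) with hA
  have hrk : 0 < r - k := sub_pos.2 hkr
  have hA0 : 0 ≤ A := by positivity
  have hCA : C ≤ A * (r - k) := by
    rw [hA, add_mul, div_mul_cancel₀ _ hrk.ne']
    nlinarith
  refine ⟨hF, hFR, A, r, hA0, hr0, hr1, fun n ε => ?_⟩
  induction n with
  | zero =>
    refine (hX ε).trans (ENNReal.ofReal_le_ofReal ?_)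
    rw [pow_zero, mul_one, hA]
    have : 0 ≤ C / (r - k) := by positivity
    linarith
  | succ n ih =>
    have hmul : AEStronglyMeasurable
        (fun z => μ (z, ε) * beltramiParam (F n) (z, ε)) volume := by
      have : (fun z => μ (z, ε) * beltramiParam (F n) (z, ε)) =
          fun z => F (n + 1) (z, ε) - G n (z, ε) := by
        ext z; rw [hrec]; ring
      rw [this]
      exact ((contDiff_slice (hF _) ε).sub (contDiff_slice (hG.smooth n) ε)).continuous
        |>.aestronglyMeasurable
    simp_rw [hrec]
    calc eLpNorm (fun z => μ (z, ε) * beltramiParam (F n) (z, ε) + G n (z, ε)) 2 volume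
        ≤ eLpNorm (fun z => μ (z, ε) * beltramiParam (F n) (z, ε)) 2 volume +
          eLpNorm (fun z => G n (z, ε)) 2 volume :=
          eLpNorm_add_le hmul
            (contDiff_slice (hG.smooth n) ε).continuous.aestronglyMeasurable (by norm_num)
      _ ≤ ENNReal.ofReal k * ENNReal.ofReal (A * r ^ n) + ENNReal.ofReal (C * q ^ n) := by
          refine add_le_add ?_ (h n ε)
          refine (eLpNorm_mul_beltrami_le (contDiff_slice (hF n) ε)
            (hasCompactSupport_slice (hFR n) ε) (fun z => hk (z, ε))).trans ?_
          gcongr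
      _ = ENNReal.ofReal (k * (A * r ^ n) + C * q ^ n) := by
          rw [← ENNReal.ofReal_mul hk0, ← ENNReal.ofReal_add (by positivity) (by positivity)]
      _ ≤ ENNReal.ofReal (A * r ^ (n + 1)) := by
          refine ENNReal.ofReal_le_ofReal ?_
          have h1 : C * q ^ n ≤ A * (r - k) * r ^ n := by gcongr
          calc _ ≤ k * (A * r ^ n) + A * (r - k) * r ^ n := by gcongr
            _ = _ := by ring

/-- A derivative of `F` satisfies the same recursion with source `(∂μ) ℬF + ∂G`. This source
involves only lower-order control of `F`, supplied by the induction hypothesis, so the contraction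
argument applies at every order. -/
theorem Ders.of_recursion {m : ℕ} (hk0 : 0 ≤ k) (hk1 : k < 1)
    (hk : ∀ p, ‖μ p‖ ≤ k) (hμ : ContDiff ℝ ∞ μ) (hμR : ∀ p, R < ‖p‖ → μ p = 0)
    (hF : ∀ n, ContDiff ℝ ∞ (F n)) (hFR : ∀ n p, R < ‖p‖ → F n p = 0)
    (hrec : ∀ n p, F (n + 1) p = μ p * beltramiParam (F n) p + G n p)
    (hG : Ders (GeomL2 R) m G) : Ders (GeomL2 R) m F := by
  induction m generalizing F G with
  | zero => exact GeomL2.of_recursion hk0 hk1 hk hF hFR hrec hG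
  | succ m ih =>
    refine ⟨GeomL2.of_recursion hk0 hk1 hk hF hFR hrec hG.1, fun e => ?_⟩
    have hFm := ih hF hFR hrec hG.of_succ
    have hG' := (hFm.mul_beltrami (contDiff_fderiv_apply hμ e)
      (fun p hp => fderiv_eq_zero_of_supported hμR hp e)).add (fun _ h => h.smooth)
      (fun _ _ => GeomL2.add) (hG.2 e)
    refine ih (fun n => contDiff_fderiv_apply (hF n) e)
      (fun n p hp => fderiv_eq_zero_of_supported (hFR n) hp e) (fun n p => ?_) hG'
    have hB := contDiff_beltramiParam (hF n) (hFR n)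
    have h1 : F (n + 1) = fun p => μ p * beltramiParam (F n) p + G n p := by
      ext p; exact hrec n p
    rw [h1, fderiv_fun_add ((hμ.mul hB).differentiable (by simp) p)
      ((hG.1.smooth n).differentiable (by simp) p),
      fderiv_fun_mul (hμ.differentiable (by simp) p) (hB.differentiable (by simp) p)]
    simp only [add_apply, smul_apply, smul_eq_mul]
    rw [fderiv_beltramiParam (hF n) (hFR n)]
    ring

theorem geomL2_zero : GeomL2 R fun _ _ => 0 :=
  ⟨fun _ => contDiff_const, fun _ _ _ => rfl, 0, 0, le_rfl, le_rfl, one_pos, fun n ε => by simp⟩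

theorem Ders.zero {m : ℕ} : Ders (GeomL2 R) m fun _ _ => 0 := by
  induction m with
  | zero => exact geomL2_zero
  | succ m ih => exact ⟨geomL2_zero, fun e => by simpa using ih⟩

end GeomL2

/-! ### From `L²` bounds to uniform bounds -/

section Sobolev

/-- The fundamental theorem of calculus along a horizontal line, then along each vertical line
meeting it. -/
theorem enorm_le_lintegral_fderiv_fderiv {f : ℂ → ℂ} (hf : ContDiff ℝ ∞ f)
    (hs : HasCompactSupport f) (z : ℂ) :
    ‖f z‖ₑ ≤ ∫⁻ w, ‖fderiv ℝ (fun q => fderiv ℝ f q 1) w Complex.I‖ₑ := by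
  obtain ⟨R, hR0, hR⟩ := exists_radius hs
  -- The hypothesis `|t| ≤ ‖b + t * e‖` forces the restriction of `g` to the line to have compact
  -- support.
  have line : ∀ (g : ℂ → ℂ), ContDiff ℝ ∞ g → (∀ w, R < ‖w‖ → g w = 0) → ∀ (b e : ℂ) (t₀ : ℝ),
      (∀ t : ℝ, |t| ≤ ‖b + t * e‖) → ‖g (b + t₀ * e)‖ₑ ≤ ∫⁻ t : ℝ, ‖fderiv ℝ g (b + t * e) e‖ₑ := by
    intro g hg hgR b e t₀ ht
    have h1 : ContDiff ℝ 1 (fun t : ℝ => g (b + t * e)) :=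
      (hg.of_le (by simp)).comp
        (contDiff_const.add (Complex.ofRealCLM.contDiff.mul contDiff_const))
    have h2 : HasCompactSupport (fun t : ℝ => g (b + t * e)) := by
      refine HasCompactSupport.intro (isCompact_Icc (a := -R) (b := R)) fun t hn => hgR _ ?_
      by_contra hcon
      exact hn (abs_le.1 ((ht t).trans (not_lt.1 hcon)))
    refine (h2.enorm_le_lintegral_Ici_deriv h1 t₀).trans ?_
    refine (setLIntegral_le_lintegral _ _).trans (lintegral_mono fun t => le_of_eq ?_)
    have h3 : HasDerivAt (fun s : ℝ => b + s * e) e t := by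
      have := ((hasDerivAt_id t).ofReal_comp.mul_const e).const_add b
      simpa using this
    have h4 : HasDerivAt (fun s : ℝ => g (b + s * e)) (fderiv ℝ g (b + t * e) e) t :=
      (hg.differentiable (by simp) _).hasFDerivAt.comp_hasDerivAt t h3
    simp only [h4.deriv]
  have hg := contDiff_fderiv_apply hf 1
  have hgR : ∀ w, R < ‖w‖ → fderiv ℝ f w 1 = 0 := by
    intro w hw
    have : f =ᶠ[𝓝 w] fun _ => 0 := by
      have ho : IsOpen {q : ℂ | R < ‖q‖} := isOpen_lt (by fun_prop) (by fun_prop)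
      filter_upwards [ho.mem_nhds hw] with q hq
      exact hR _ hq
    rw [this.fderiv_eq]
    simp
  have h5 : ∀ s y : ℝ, (s : ℂ) + y * Complex.I = ⟨s, y⟩ := fun s y =>
    (Complex.mk_eq_add_mul_I s y).symm
  have habs : ∀ s y : ℝ, |s| ≤ ‖(⟨s, y⟩ : ℂ)‖ ∧ |y| ≤ ‖(⟨s, y⟩ : ℂ)‖ := fun s y =>
    ⟨Complex.abs_re_le_norm ⟨s, y⟩, Complex.abs_im_le_norm ⟨s, y⟩⟩
  have hx := line f hf hR (z.im * Complex.I) 1 z.re (fun t => by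
    rw [mul_one, add_comm, h5]; exact (habs _ _).1)
  have hy : ∀ s : ℝ, ‖fderiv ℝ f (z.im * Complex.I + s * 1) 1‖ₑ ≤
      ∫⁻ t : ℝ, ‖fderiv ℝ (fun q => fderiv ℝ f q 1) (s + t * Complex.I) Complex.I‖ₑ := by
    intro s
    have := line _ hg hgR s Complex.I z.im (fun t => by rw [h5]; exact (habs _ _).2)
    rwa [mul_one, add_comm]
  have hz : (z.im * Complex.I + z.re * 1 : ℂ) = z := by
    rw [mul_one, add_comm, Complex.re_add_im]
  rw [hz] at hx
  refine hx.trans ((lintegral_mono hy).trans_eq ?_)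
  set H : ℂ → ENNReal := fun w => ‖fderiv ℝ (fun q => fderiv ℝ f q 1) w Complex.I‖ₑ with hH
  have hHm : Measurable H := (contDiff_fderiv_apply hg Complex.I).continuous.enorm.measurable
  rw [← Complex.volume_preserving_equiv_real_prod.symm.lintegral_comp hHm,
    Measure.volume_eq_prod, lintegral_prod
      (fun a : ℝ × ℝ => H (Complex.measurableEquivRealProd.symm a))
      (hHm.comp Complex.measurableEquivRealProd.symm.measurable).aemeasurable]
  simp only [h5]
  rfl

theorem lintegral_enorm_le {f : ℂ → ℂ} {R : ℝ} (hf : Continuous f) (hR : ∀ w, R < ‖w‖ → f w = 0) :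
    ∫⁻ w, ‖f w‖ₑ ≤ eLpNorm f 2 volume * volume (Metric.closedBall (0 : ℂ) R) ^ (1 / 2 : ℝ) := by
  have hsub : Function.support f ⊆ Metric.closedBall (0 : ℂ) R := by
    intro z hz
    by_contra h
    exact hz (hR z (by simpa using h))
  rw [← eLpNorm_one_eq_lintegral_enorm, ← eLpNorm_restrict_eq_of_support_subset hsub,
    ← eLpNorm_restrict_eq_of_support_subset (p := 2) hsub]
  refine (eLpNorm_le_eLpNorm_mul_rpow_measure_univ (p := 1) (q := 2) (by norm_num)
    hf.aestronglyMeasurable).trans_eq ?_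
  rw [Measure.restrict_apply_univ]
  norm_num

theorem GeomL2.exists_bound {R : ℝ} {F : ℕ → ℂ × ℝ → ℂ} (hF : Ders (GeomL2 R) 2 F) :
    ∃ C q : ℝ, 0 ≤ C ∧ 0 ≤ q ∧ q < 1 ∧ ∀ n p, ‖F n p‖ ≤ C * q ^ n := by
  have hG := (hF.2 (1, 0)).2 (Complex.I, 0)
  obtain ⟨C, q, hC, hq, hq1, h⟩ := hG.self.bound
  set B := volume (Metric.closedBall (0 : ℂ) R) ^ (1 / 2 : ℝ) with hB
  have hBt : B ≠ ⊤ := ENNReal.rpow_ne_top_of_nonneg (by simp) measure_closedBall_lt_top.ne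
  refine ⟨C * B.toReal, q, by positivity, hq, hq1, ?_⟩
  rintro n ⟨z, ε⟩
  have hFn := hF.1.smooth n
  have h1 := enorm_le_lintegral_fderiv_fderiv (contDiff_slice hFn ε)
    (hasCompactSupport_slice (hF.1.supp n) ε) z
  have h2 : ∀ w, fderiv ℝ (fun q => fderiv ℝ (fun w => F n (w, ε)) q 1) w Complex.I =
      fderiv ℝ (fun p => fderiv ℝ (F n) p (1, 0)) (w, ε) (Complex.I, 0) := by
    intro w
    simp_rw [fderiv_slice (hFn.differentiable (by simp))]
    exact fderiv_slice ((contDiff_fderiv_apply hFn _).differentiable (by simp)) w Complex.I ε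
  simp_rw [h2] at h1
  have h3 := h1.trans (lintegral_enorm_le (R := R)
    (contDiff_slice (hG.self.smooth n) ε).continuous
    (slice_eq_zero (hG.self.supp n) ε))
  have h4 : ‖F n (z, ε)‖ₑ ≤ ENNReal.ofReal (C * B.toReal * q ^ n) := by
    calc _ ≤ _ := h3
      _ ≤ ENNReal.ofReal (C * q ^ n) * B := by
        gcongr
        exact h n ε
      _ = _ := by
        rw [mul_right_comm, ENNReal.ofReal_mul (p := C * q ^ n) (by positivity),
          ENNReal.ofReal_toReal hBt]
  rw [← ofReal_norm] at h4
  exact (ENNReal.ofReal_le_ofReal_iff (by positivity)).1 h4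

end Sobolev

/-! ### Geometrically convergent series of decaying functions -/

/-- The functions `F n` are smooth and bounded by `C qⁿ (1 + |z|)⁻¹` with `q < 1`. -/
structure GeomDecay (F : ℕ → ℂ × ℝ → ℂ) : Prop where
  smooth : ∀ n, ContDiff ℝ ∞ (F n)
  bound : ∃ C q : ℝ, 0 ≤ C ∧ 0 ≤ q ∧ q < 1 ∧ ∀ n z ε,
    ‖F n (z, ε)‖ ≤ C * q ^ n * (1 + ‖z‖)⁻¹

/-- All iterated derivatives of the functions `F n` satisfy bounds `C qⁿ (1 + |z|)⁻¹`. -/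
def GeomDecayAll (F : ℕ → ℂ × ℝ → ℂ) : Prop := ∀ k, Ders GeomDecay k F

/-- Two orders are lost in passing from `L²` to the supremum norm; the Cauchy transform itself
commutes with derivatives and loses none. -/
theorem Ders.cauchyParam {R : ℝ} (hR0 : 0 ≤ R) {k : ℕ} {F : ℕ → ℂ × ℝ → ℂ}
    (hF : Ders (GeomL2 R) (k + 2) F) : Ders GeomDecay k fun n => cauchyParam (F n) := by
  have hb : ∀ {F : ℕ → ℂ × ℝ → ℂ}, Ders (GeomL2 R) 2 F →
      GeomDecay fun n => Beltrami.cauchyParam (F n) := by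
    intro F hF
    obtain ⟨K, hK0, hK⟩ := exists_cauchy_bound hR0
    obtain ⟨C, q, hC, hq, hq1, h⟩ := GeomL2.exists_bound hF
    refine ⟨fun n => contDiff_cauchyParam (hF.1.smooth n)
      fun p hp => hF.1.supp n p (hp.trans_le (norm_fst_le p)), K * C, q, by positivity, hq, hq1,
      fun n z ε => ?_⟩
    refine (hK (fun w => F n (w, ε)) (C * q ^ n) (by positivity) (fun w => h n _)
      (slice_eq_zero (hF.1.supp n) ε) z).trans_eq ?_
    ring
  induction k generalizing F with
  | zero => exact hb hF
  | succ k ih =>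
    refine ⟨hb (hF.mono (by omega)), fun e => ?_⟩
    convert ih (hF.2 e) using 3 with n p
    exact fderiv_cauchyParam (hF.1.smooth n)
      (fun p hp => hF.1.supp n p (hp.trans_le (norm_fst_le p))) p e

section Series

variable {F G : ℕ → ℂ × ℝ → ℂ}

theorem GeomDecay.add (hF : GeomDecay F) (hG : GeomDecay G) :
    GeomDecay fun n p => F n p + G n p := by
  obtain ⟨C, q, hC, hq, hq1, h⟩ := hF.bound
  obtain ⟨C', q', hC', hq', hq1', h'⟩ := hG.bound
  refine ⟨fun n => (hF.smooth n).add (hG.smooth n), C + C', max q q', by positivity,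
    le_max_of_le_left hq, max_lt hq1 hq1', fun n z ε => (norm_add_le _ _).trans ?_⟩
  calc _ ≤ C * q ^ n * (1 + ‖z‖)⁻¹ + C' * q' ^ n * (1 + ‖z‖)⁻¹ := add_le_add (h n z ε) (h' n z ε)
    _ = (C * q ^ n + C' * q' ^ n) * (1 + ‖z‖)⁻¹ := by ring
    _ ≤ _ := by
      gcongr
      exact geom_add_le hC hC' hq hq' n

theorem GeomDecay.const_mul (c : ℂ) (hF : GeomDecay F) : GeomDecay fun n p => c * F n p := by
  obtain ⟨C, q, hC, hq, hq1, h⟩ := hF.bound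
  refine ⟨fun n => contDiff_const.mul (hF.smooth n), ‖c‖ * C, q, by positivity, hq, hq1,
    fun n z ε => ?_⟩
  rw [norm_mul, mul_assoc, mul_assoc ‖c‖, ← mul_assoc C]
  gcongr
  exact h n z ε

theorem GeomDecay.exists_summable (hF : GeomDecay F) :
    ∃ u : ℕ → ℝ, Summable u ∧ ∀ n p, ‖F n p‖ ≤ u n := by
  obtain ⟨C, q, hC, hq, hq1, h⟩ := hF.bound
  refine ⟨fun n => C * q ^ n, (summable_geometric_of_lt_one hq hq1).mul_left C, ?_⟩
  rintro n ⟨z, ε⟩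
  exact (h n z ε).trans (mul_le_of_le_one_right (by positivity)
    (inv_le_one_of_one_le₀ (by linarith [norm_nonneg z])))

theorem GeomDecay.summable (hF : GeomDecay F) (p : ℂ × ℝ) : Summable fun n => F n p := by
  obtain ⟨u, hu, h⟩ := hF.exists_summable
  exact Summable.of_norm_bounded hu fun n => h n p

theorem GeomDecay.tendstoUniformly (hF : GeomDecay F) :
    TendstoUniformly (fun (N : ℕ) (p : ℂ × ℝ) => ∑ n ∈ Finset.range N, F n p)
      (fun p => ∑' n, F n p) atTop := by
  obtain ⟨u, hu, h⟩ := hF.exists_summable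
  exact tendstoUniformly_tsum_nat hu h

theorem GeomDecay.exists_tsum_bound (hF : GeomDecay F) : ∃ C : ℝ, ∀ (z : ℂ) (ε : ℝ),
    ‖∑' n, F n (z, ε)‖ ≤ C * (1 + ‖z‖)⁻¹ ∧ ∀ n, ‖F n (z, ε)‖ ≤ C * (1 + ‖z‖)⁻¹ := by
  obtain ⟨C, q, hC, hq, hq1, h⟩ := hF.bound
  -- The sum of the geometric series also bounds each single term, so one constant serves both
  -- claims.
  refine ⟨C * (1 - q)⁻¹, fun z ε => ⟨?_, fun n => ?_⟩⟩
  · have hs := ((hasSum_geometric_of_lt_one hq hq1).mul_left C).mul_right (1 + ‖z‖)⁻¹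
    exact tsum_of_norm_bounded hs fun n => h n z ε
  · refine (h n z ε).trans ?_
    have h1 : q ^ n ≤ 1 := pow_le_one₀ hq hq1.le
    have h2 : 1 ≤ (1 - q)⁻¹ := (one_le_inv₀ (by linarith)).2 (by linarith)
    gcongr
    exact h1.trans h2

theorem GeomDecayAll.self (hF : GeomDecayAll F) : GeomDecay F := hF 0

theorem GeomDecayAll.fderiv (hF : GeomDecayAll F) (e : ℂ × ℝ) :
    GeomDecayAll fun n p => fderiv ℝ (F n) p e := fun k => (hF (k + 1)).2 e

theorem GeomDecayAll.add (hF : GeomDecayAll F) (hG : GeomDecayAll G) :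
    GeomDecayAll fun n p => F n p + G n p := fun k =>
  (hF k).add (fun _ h => h.smooth) (fun _ _ => GeomDecay.add) (hG k)

theorem GeomDecayAll.const_mul (c : ℂ) (hF : GeomDecayAll F) :
    GeomDecayAll fun n p => c * F n p := fun k =>
  (hF k).const_mul (fun _ h => h.smooth) c (fun _ => GeomDecay.const_mul c)

theorem norm_le_of_basis (L : ℂ × ℝ →L[ℝ] ℂ) :
    ‖L‖ ≤ ‖L (1, 0)‖ + ‖L (Complex.I, 0)‖ + ‖L (0, 1)‖ := by
  refine L.opNorm_le_bound (by positivity) ?_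
  rintro ⟨z, t⟩
  have h : ((z, t) : ℂ × ℝ) = z.re • ((1 : ℂ), (0 : ℝ)) + z.im • (Complex.I, (0 : ℝ)) +
      t • ((0 : ℂ), (1 : ℝ)) := by
    ext <;> simp
  have h1 : |z.re| ≤ ‖((z, t) : ℂ × ℝ)‖ := (Complex.abs_re_le_norm z).trans (norm_fst_le (z, t))
  have h2 : |z.im| ≤ ‖((z, t) : ℂ × ℝ)‖ := (Complex.abs_im_le_norm z).trans (norm_fst_le (z, t))
  have h3 : |t| ≤ ‖((z, t) : ℂ × ℝ)‖ := norm_snd_le (z, t)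
  calc ‖L (z, t)‖ = ‖z.re • L (1, 0) + z.im • L (Complex.I, 0) + t • L (0, 1)‖ := by
        rw [h, map_add, map_add, map_smul, map_smul, map_smul]
    _ ≤ |z.re| * ‖L (1, 0)‖ + |z.im| * ‖L (Complex.I, 0)‖ + |t| * ‖L (0, 1)‖ := by
        refine (norm_add₃_le).trans_eq ?_
        simp
    _ ≤ ‖((z, t) : ℂ × ℝ)‖ * ‖L (1, 0)‖ + ‖((z, t) : ℂ × ℝ)‖ * ‖L (Complex.I, 0)‖ +
        ‖((z, t) : ℂ × ℝ)‖ * ‖L (0, 1)‖ := by gcongr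
    _ = _ := by ring

/-- Summable bounds in the three basis directions give a summable bound on operator norms, as
termwise differentiation requires. -/
theorem GeomDecayAll.hasFDerivAt_tsum (hF : GeomDecayAll F) (p : ℂ × ℝ) :
    HasFDerivAt (fun q => ∑' n, F n q) (∑' n, _root_.fderiv ℝ (F n) p) p ∧
      Summable fun n => _root_.fderiv ℝ (F n) p := by
  obtain ⟨u₁, hu₁, h₁⟩ := (hF.fderiv (1, 0)).self.exists_summable
  obtain ⟨u₂, hu₂, h₂⟩ := (hF.fderiv (Complex.I, 0)).self.exists_summable
  obtain ⟨u₃, hu₃, h₃⟩ := (hF.fderiv (0, 1)).self.exists_summable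
  have hu := (hu₁.add hu₂).add hu₃
  have hb : ∀ n q, ‖_root_.fderiv ℝ (F n) q‖ ≤ u₁ n + u₂ n + u₃ n := fun n q =>
    (norm_le_of_basis _).trans (add_le_add (add_le_add (h₁ n q) (h₂ n q)) (h₃ n q))
  exact ⟨_root_.hasFDerivAt_tsum hu
    (fun n q => ((hF.self.smooth n).differentiable (by simp) q).hasFDerivAt) hb
    (hF.self.summable p) p, Summable.of_norm_bounded hu fun n => hb n p⟩

theorem GeomDecayAll.fderiv_tsum (hF : GeomDecayAll F) (p e : ℂ × ℝ) :
    _root_.fderiv ℝ (fun q => ∑' n, F n q) p e = ∑' n, _root_.fderiv ℝ (F n) p e := by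
  obtain ⟨h, hs⟩ := hF.hasFDerivAt_tsum p
  rw [h.fderiv]
  exact (ContinuousLinearMap.apply ℝ ℂ e).map_tsum hs

theorem GeomDecayAll.differentiable_tsum (hF : GeomDecayAll F) :
    Differentiable ℝ fun q => ∑' n, F n q := fun p =>
  (hF.hasFDerivAt_tsum p).1.differentiableAt

theorem GeomDecayAll.contDiff_tsum (hF : GeomDecayAll F) :
    ContDiff ℝ ∞ fun q => ∑' n, F n q := by
  rw [contDiff_infty]
  intro m
  induction m generalizing F with
  | zero =>
    exact contDiff_zero.2 hF.differentiable_tsum.continuous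
  | succ m ih =>
    push_cast
    rw [contDiff_succ_iff_fderiv_apply]
    refine ⟨hF.differentiable_tsum, by simp, fun e => ?_⟩
    simp_rw [fun p => hF.fderiv_tsum p e]
    exact ih (hF.fderiv e)

/-- An operator that preserves geometrically convergent series of decaying functions and can be
applied to them term by term. -/
def TermByTerm (T : (ℂ × ℝ → ℂ) → ℂ × ℝ → ℂ) : Prop :=
  ∀ F : ℕ → ℂ × ℝ → ℂ, GeomDecayAll F → GeomDecayAll (fun n => T (F n)) ∧
    T (fun p => ∑' n, F n p) = fun p => ∑' n, T (F n) p

theorem TermByTerm.iterate {T : (ℂ × ℝ → ℂ) → ℂ × ℝ → ℂ} (hT : TermByTerm T) (m : ℕ) :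
    TermByTerm T^[m] := by
  induction m with
  | zero => exact fun F hF => ⟨hF, rfl⟩
  | succ m ih =>
    intro F hF
    obtain ⟨h1, h2⟩ := hT F hF
    obtain ⟨h3, h4⟩ := ih _ h1
    refine ⟨h3, ?_⟩
    rw [Function.iterate_succ_apply, h2, h4]
    rfl

theorem TermByTerm.comp {T S : (ℂ × ℝ → ℂ) → ℂ × ℝ → ℂ} (hT : TermByTerm T)
    (hS : TermByTerm S) : TermByTerm fun F => T (S F) := by
  intro F hF
  obtain ⟨h1, h2⟩ := hS F hF
  obtain ⟨h3, h4⟩ := hT _ h1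
  refine ⟨h3, ?_⟩
  simp only [h2, h4]

theorem GeomDecayAll.differentiable (hF : GeomDecayAll F) (n : ℕ) : Differentiable ℝ (F n) :=
  (hF.self.smooth n).differentiable (by simp)

theorem termByTerm_partialEps : TermByTerm partialEps := by
  intro F hF
  simp_rw [fun n => partialEps_eq (hF.differentiable n), partialEps_eq hF.differentiable_tsum,
    hF.fderiv_tsum]
  exact ⟨hF.fderiv _, trivial⟩

theorem termByTerm_combination (a b : ℂ) (hF : GeomDecayAll F) :
    GeomDecayAll (fun n p => a * _root_.fderiv ℝ (F n) p (1, 0) +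
      b * _root_.fderiv ℝ (F n) p (Complex.I, 0)) ∧
    (fun p => a * _root_.fderiv ℝ (fun q => ∑' n, F n q) p (1, 0) +
      b * _root_.fderiv ℝ (fun q => ∑' n, F n q) p (Complex.I, 0)) =
    fun p => ∑' n, (a * _root_.fderiv ℝ (F n) p (1, 0) +
      b * _root_.fderiv ℝ (F n) p (Complex.I, 0)) := by
  have h1 := (hF.fderiv (1, 0)).const_mul a
  have h2 := (hF.fderiv (Complex.I, 0)).const_mul b
  refine ⟨h1.add h2, ?_⟩
  ext p
  rw [(h1.self.summable p).tsum_add (h2.self.summable p), hF.fderiv_tsum, hF.fderiv_tsum,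
    tsum_mul_left, tsum_mul_left]

theorem termByTerm_partialZ : TermByTerm partialZ := by
  intro F hF
  simp_rw [fun n => partialZ_eq (hF.differentiable n), partialZ_eq hF.differentiable_tsum]
  exact termByTerm_combination _ _ hF

theorem termByTerm_partialZbar : TermByTerm partialZbar := by
  intro F hF
  simp_rw [fun n => partialZbar_eq (hF.differentiable n), partialZbar_eq hF.differentiable_tsum]
  exact termByTerm_combination _ _ hF

theorem termByTerm_D (l : ℕ × ℕ × ℕ) : TermByTerm (D l) :=
  (termByTerm_partialEps.iterate _).comp
    ((termByTerm_partialZ.iterate _).comp (termByTerm_partialZbar.iterate _))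

end Series

/-! ### The Neumann series -/

/-- The terms `(μ ℬ)ⁿ a` of the Neumann series with parameter. -/
noncomputable def neumann (μ a : ℂ × ℝ → ℂ) : ℕ → ℂ × ℝ → ℂ
  | 0 => a
  | n + 1 => fun p => μ p * beltramiParam (neumann μ a n) p

theorem neumann_succ_apply (μ a : ℂ × ℝ → ℂ) (n : ℕ) (p : ℂ × ℝ) :
    neumann μ a (n + 1) p = μ p * beltramiParam (neumann μ a n) p := rfl

/-- The sum `∑ 𝒞 (μ ℬ)ⁿ a`. -/
noncomputable def solution (μ a : ℂ × ℝ → ℂ) (p : ℂ × ℝ) : ℂ :=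
  ∑' n, cauchyParam (neumann μ a n) p

theorem v_eq_neumann (μ : ℂ × ℝ → ℂ) (n : ℕ) : v μ n = neumann μ μ n := by
  induction n with
  | zero => rfl
  | succ n ih =>
    ext ⟨z, ε⟩
    rw [neumann_succ_apply, beltramiParam_apply, ← ih]
    simp only [v, iterate, Function.iterate_succ_apply']

theorem uTerm_eq (μ : ℂ × ℝ → ℂ) (n : ℕ) : uTerm μ n = cauchyParam (neumann μ μ n) := by
  rw [← v_eq_neumann]
  rfl

theorem uSum_eq (μ : ℂ × ℝ → ℂ) : uSum μ = solution μ μ := by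
  ext p
  simp only [uSum, solution, uTerm_eq]

/-- A smooth Beltrami coefficient with parameter, supported in the ball of radius `R` and bounded
by `k < 1`. -/
structure IsCoefficient (R k : ℝ) (μ : ℂ × ℝ → ℂ) : Prop where
  smooth : ContDiff ℝ ∞ μ
  radius_nonneg : 0 ≤ R
  supp : ∀ p, R < ‖p‖ → μ p = 0
  nonneg : 0 ≤ k
  lt_one : k < 1
  bound : ∀ p, ‖μ p‖ ≤ k

theorem exists_isCoefficient {μ : ℂ × ℝ → ℂ} (hsmooth : ContDiff ℝ ∞ μ)
    (hsupp : HasCompactSupport μ) (hnorm : eLpNorm μ ⊤ volume < 1) :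
    ∃ R k : ℝ, IsCoefficient R k μ := by
  obtain ⟨R, hR0, hR⟩ := exists_radius_param hsupp
  have hne : eLpNorm μ ⊤ volume ≠ ⊤ := hnorm.ne_top
  refine ⟨R, (eLpNorm μ ⊤ volume).toReal, hsmooth, hR0, hR, ENNReal.toReal_nonneg, ?_, ?_⟩
  · rw [← ENNReal.toReal_one]
    exact (ENNReal.toReal_lt_toReal hne ENNReal.one_ne_top).2 hnorm
  · have hae : ∀ᵐ p : ℂ × ℝ, ‖μ p‖ ≤ (eLpNorm μ ⊤ volume).toReal := by
      rw [eLpNorm_exponent_top] at hne ⊢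
      filter_upwards [ae_le_eLpNormEssSup (f := μ) (μ := volume)] with p hp
      have := ENNReal.toReal_mono hne hp
      simpa using this
    -- A continuous function obeys its almost-everywhere bound at every point: the set is closed,
    -- and dense because its complement is null.
    have hcl : IsClosed {p : ℂ × ℝ | ‖μ p‖ ≤ (eLpNorm μ ⊤ volume).toReal} :=
      isClosed_le hsmooth.continuous.norm continuous_const
    have hd := Measure.dense_of_ae hae
    have : {p : ℂ × ℝ | ‖μ p‖ ≤ (eLpNorm μ ⊤ volume).toReal} = univ := by
      rw [← hcl.closure_eq, hd.closure_eq]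
    exact fun p => this.ge (mem_univ p)

section Neumann

variable {R k : ℝ} {μ a : ℂ × ℝ → ℂ}

theorem neumann_spec (hμ : IsCoefficient R k μ) (ha : ContDiff ℝ ∞ a)
    (haR : ∀ p, R < ‖p‖ → a p = 0) (n : ℕ) :
    ContDiff ℝ ∞ (neumann μ a n) ∧ ∀ p, R < ‖p‖ → neumann μ a n p = 0 := by
  induction n with
  | zero => exact ⟨ha, haR⟩
  | succ n ih =>
    exact ⟨hμ.smooth.mul (contDiff_beltramiParam ih.1 ih.2),
      fun p hp => by rw [neumann_succ_apply, hμ.supp p hp, zero_mul]⟩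

/-- The series starts from a general `a`: it is used with `a = μ` for `u` and with `a = ∂_z μ` for
the logarithm of `1 + ∂_z u`. The recursion itself has zero source; sources arise only on
differentiating it. -/
theorem geomDecayAll_neumann (hμ : IsCoefficient R k μ) (ha : ContDiff ℝ ∞ a)
    (haR : ∀ p, R < ‖p‖ → a p = 0) : GeomDecayAll fun n => cauchyParam (neumann μ a n) := by
  intro m
  refine Ders.cauchyParam hμ.radius_nonneg (R := R) ?_
  exact Ders.of_recursion hμ.nonneg hμ.lt_one hμ.bound hμ.smooth hμ.supp
    (fun n => (neumann_spec hμ ha haR n).1) (fun n => (neumann_spec hμ ha haR n).2)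
    (G := fun _ _ => 0) (fun n p => by rw [neumann_succ_apply, add_zero]) Ders.zero

theorem contDiff_solution (hμ : IsCoefficient R k μ) (ha : ContDiff ℝ ∞ a)
    (haR : ∀ p, R < ‖p‖ → a p = 0) : ContDiff ℝ ∞ (solution μ a) :=
  (geomDecayAll_neumann hμ ha haR).contDiff_tsum

/-- Termwise, `∂_{z̄}` recovers the `n`-th Neumann term and `μ ∂_z` produces the next one; splitting
off the zeroth term gives the equation. -/
theorem partialZbar_solution (hμ : IsCoefficient R k μ) (ha : ContDiff ℝ ∞ a)
    (haR : ∀ p, R < ‖p‖ → a p = 0) (p : ℂ × ℝ) :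
    partialZbar (solution μ a) p = a p + μ p * partialZ (solution μ a) p := by
  have hG := geomDecayAll_neumann hμ ha haR
  obtain ⟨h1, h2⟩ := termByTerm_partialZbar _ hG
  obtain ⟨h3, h4⟩ := termByTerm_partialZ _ hG
  have h5 : ∀ n, partialZbar (cauchyParam (neumann μ a n)) = neumann μ a n := by
    intro n
    obtain ⟨hs, hR⟩ := neumann_spec hμ ha haR n
    ext ⟨z, ε⟩
    exact dzbar_cauchy (contDiff_slice hs ε) (hasCompactSupport_slice hR ε) z
  simp_rw [h5] at h1 h2
  change partialZbar (fun p => ∑' n, cauchyParam (neumann μ a n) p) p =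
    a p + μ p * partialZ (fun p => ∑' n, cauchyParam (neumann μ a n) p) p
  rw [h2, h4, ← tsum_mul_left]
  exact (h1.self.summable p).tsum_eq_zero_add

theorem exists_solution_decay (hμ : IsCoefficient R k μ) (ha : ContDiff ℝ ∞ a)
    (haR : ∀ p, R < ‖p‖ → a p = 0) :
    ∃ C : ℝ, ∀ z ε, ‖solution μ a (z, ε)‖ ≤ C * (1 + ‖z‖)⁻¹ := by
  obtain ⟨C, hC⟩ := (geomDecayAll_neumann hμ ha haR).self.exists_tsum_bound
  exact ⟨C, fun z ε => (hC z ε).1⟩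

theorem exists_fderiv_solution_decay (hμ : IsCoefficient R k μ) (ha : ContDiff ℝ ∞ a)
    (haR : ∀ p, R < ‖p‖ → a p = 0) (e : ℂ × ℝ) :
    ∃ C : ℝ, ∀ z ε, ‖fderiv ℝ (solution μ a) (z, ε) e‖ ≤ C * (1 + ‖z‖)⁻¹ := by
  have hG := geomDecayAll_neumann hμ ha haR
  obtain ⟨C, hC⟩ := (hG.fderiv e).self.exists_tsum_bound
  refine ⟨C, fun z ε => ?_⟩
  have := (hC z ε).1
  rwa [← hG.fderiv_tsum] at this

/-- Liouville uniqueness applied to the Beltrami equation, which avoids exchanging `𝒞` with the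
infinite sum. -/
theorem solution_eq_cauchy (hμ : IsCoefficient R k μ) (ha : ContDiff ℝ ∞ a)
    (haR : ∀ p, R < ‖p‖ → a p = 0) (z : ℂ) (ε : ℝ) :
    solution μ a (z, ε) = cauchy (fun w => a (w, ε)) z +
      cauchy (fun w => μ (w, ε) * partialZ (solution μ a) (w, ε)) z := by
  have hS := contDiff_solution hμ ha haR
  obtain ⟨C, hC⟩ := exists_solution_decay hμ ha haR
  have hμZ : ContDiff ℝ ∞ fun p => μ p * partialZ (solution μ a) p :=
    hμ.smooth.mul (contDiff_partialZ hS)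
  have hμZR : ∀ p, R < ‖p‖ → μ p * partialZ (solution μ a) p = 0 := fun p hp => by
    rw [hμ.supp p hp, zero_mul]
  have h := eq_cauchy_of_tendsto (contDiff_slice hS ε) (tendsto_of_decay fun z => hC z ε)
    (f := fun w => a (w, ε) + μ (w, ε) * partialZ (solution μ a) (w, ε))
    ((contDiff_slice ha ε).add (contDiff_slice hμZ ε))
    ((hasCompactSupport_slice haR ε).add (hasCompactSupport_slice hμZR ε))
    (fun z => partialZbar_solution hμ ha haR (z, ε))
  rw [← cauchy_add (contDiff_slice ha ε).continuous (hasCompactSupport_slice haR ε)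
    (contDiff_slice hμZ ε).continuous (hasCompactSupport_slice hμZR ε)]
  exact congrFun h z

end Neumann

/-! ### Non-vanishing of `∂_z (z + u)` -/

/-- A solution of the homogeneous Beltrami equation that vanishes at infinity is zero. -/
theorem eq_zero_of_beltrami_equation {m r : ℂ → ℂ} {k : ℝ} (hk1 : k < 1)
    (hm : ContDiff ℝ ∞ m) (hms : HasCompactSupport m) (hmk : ∀ z, ‖m z‖ ≤ k)
    (hr : ContDiff ℝ ∞ r) (h0 : Tendsto r (cocompact ℂ) (𝓝 0))
    (hd : ∀ z, dzbar r z = m z * dz r z) : r = 0 := by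
  have hdz : ContDiff ℝ ∞ (dz r) :=
    ((contDiff_fderiv_apply hr 1).sub
      (contDiff_const.mul (contDiff_fderiv_apply hr Complex.I))).div_const 2
  -- Here `φ = ∂_{z̄} r`, so `r = 𝒞 φ` and `φ = m ℬφ`. The contraction estimate, with a finite `L²`
  -- norm, leaves only `φ = 0`.
  set φ : ℂ → ℂ := fun z => m z * dz r z with hφ
  have hφs : ContDiff ℝ ∞ φ := hm.mul hdz
  have hφc : HasCompactSupport φ := hms.mul_right
  have hrφ : r = cauchy φ := eq_cauchy_of_tendsto hr h0 hφs hφc hd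
  have hφB : φ = fun z => m z * beltrami φ z := by
    ext z
    rw [beltrami, ← hrφ]
  have hle : eLpNorm φ 2 volume ≤ ENNReal.ofReal k * eLpNorm φ 2 volume := by
    conv_lhs => rw [hφB]
    exact eLpNorm_mul_beltrami_le hφs hφc hmk
  have hfin : eLpNorm φ 2 volume ≠ ⊤ :=
    (hφs.continuous.memLp_of_hasCompactSupport hφc).eLpNorm_ne_top
  have hzero : eLpNorm φ 2 volume = 0 := by
    by_contra hne
    have h1 : ENNReal.ofReal k < 1 := by
      rw [← ENNReal.ofReal_one]
      exact (ENNReal.ofReal_lt_ofReal_iff one_pos).2 hk1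
    have h2 := ENNReal.mul_lt_mul_left hne hfin h1
    rw [one_mul] at h2
    exact absurd hle (not_le.2 h2)
  have hae := (eLpNorm_eq_zero_iff hφs.continuous.aestronglyMeasurable (by norm_num)).1 hzero
  have hφ0 : φ = 0 := (Continuous.ae_eq_iff_eq volume hφs.continuous continuous_const).1 hae
  rw [hrφ, hφ0]
  ext z
  simp [cauchy]

/-- Differentiating the Beltrami equation gives `∂_{z̄} P = (∂_z μ) P + μ ∂_z P`, and `exp σ` solves
the same equation. Their quotient is annihilated by `∂_{z̄} - μ ∂_z` and tends to `1` at infinity,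
so `P = exp σ`. -/
theorem one_add_partialZ_solution_ne_zero {R k : ℝ} {μ : ℂ × ℝ → ℂ} (hμ : IsCoefficient R k μ)
    (z : ℂ) (ε : ℝ) : 1 + partialZ (solution μ μ) (z, ε) ≠ 0 := by
  have haS : ContDiff ℝ ∞ (partialZ μ) := contDiff_partialZ hμ.smooth
  have haR : ∀ p, R < ‖p‖ → partialZ μ p = 0 := by
    intro p hp
    rw [partialZ_eq (hμ.smooth.differentiable (by simp))]
    simp [fderiv_eq_zero_of_supported hμ.supp hp]
  set U := solution μ μ with hU
  set σ := solution μ (partialZ μ) with hσ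
  have hUs : ContDiff ℝ ∞ U := contDiff_solution hμ hμ.smooth hμ.supp
  have hσs : ContDiff ℝ ∞ σ := contDiff_solution hμ haS haR
  set P : ℂ × ℝ → ℂ := fun p => 1 + partialZ U p with hP
  have hPs : ContDiff ℝ ∞ P := contDiff_const.add (contDiff_partialZ hUs)
  have hUd : Differentiable ℝ U := hUs.differentiable (by simp)
  set r : ℂ × ℝ → ℂ := fun p => P p * Complex.exp (-σ p) - 1 with hr
  have hrs : ContDiff ℝ ∞ r := (hPs.mul hσs.neg.cexp).sub contDiff_const
  have hfr : ∀ p e, fderiv ℝ r p e =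
      Complex.exp (-σ p) * (fderiv ℝ P p e - P p * fderiv ℝ σ p e) := by
    intro p e
    have h1 : HasFDerivAt r _ p := ((hPs.differentiable (by simp) p).hasFDerivAt.mul
      ((hσs.differentiable (by simp) p).hasFDerivAt.neg.cexp)).sub_const 1
    rw [h1.fderiv]
    simp only [add_apply, smul_apply, neg_apply, smul_eq_mul, Pi.neg_apply]
    ring
  have hrd : Differentiable ℝ r := hrs.differentiable (by simp)
  have hPd : Differentiable ℝ P := hPs.differentiable (by simp)
  have hσd : Differentiable ℝ σ := hσs.differentiable (by simp)
  have hPe : ∀ p e, fderiv ℝ P p e = partialZ (fun q => fderiv ℝ U q e) p := by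
    intro p e
    rw [← fderiv_partialZ hUs, hP, fderiv_const_add]
  have hUeq : partialZbar U = fun p => μ p * P p := by
    ext p
    rw [hU, partialZbar_solution hμ hμ.smooth hμ.supp, ← hU, hP]
    ring
  have hcomm : partialZbar P = partialZ (partialZbar U) := by
    have hc := fderiv_apply_comm hUs
    have hd : ∀ e, Differentiable ℝ fun q => fderiv ℝ U q e := fun e =>
      (contDiff_fderiv_apply hUs e).differentiable (by simp)
    have hdb : Differentiable ℝ (partialZbar U) := by
      rw [hUeq]
      exact (hμ.smooth.mul hPs).differentiable (by simp)
    ext p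
    have h2 : ∀ e, fderiv ℝ (partialZbar U) p e = (1 / 2 : ℂ) *
        fderiv ℝ (fun q => fderiv ℝ U q (1, 0)) p e + (Complex.I / 2) *
        fderiv ℝ (fun q => fderiv ℝ U q (Complex.I, 0)) p e := by
      intro e
      rw [partialZbar_eq hUd, fderiv_fun_add ((hd _).const_mul _ p) ((hd _).const_mul _ p),
        fderiv_const_mul (hd _ p), fderiv_const_mul (hd _ p)]
      rfl
    rw [partialZbar_eq hPd, partialZ_eq hdb]
    simp only [hPe, h2, partialZ_eq (hd _)]
    rw [hc p (Complex.I, 0) (1, 0)]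
    ring
  have hPeq : ∀ p, partialZbar P p = partialZ μ p * P p + μ p * partialZ P p := by
    intro p
    have hμd : Differentiable ℝ μ := hμ.smooth.differentiable (by simp)
    rw [hcomm, hUeq, partialZ_eq (hμd.fun_mul hPd), partialZ_eq hμd, partialZ_eq hPd]
    simp only [fderiv_fun_mul (hμd p) (hPd p), add_apply, smul_apply, smul_eq_mul]
    ring
  have hreq : ∀ p, partialZbar r p = μ p * partialZ r p := by
    intro p
    have h1 := hPeq p
    have h2 : partialZbar σ p = partialZ μ p + μ p * partialZ σ p :=
      partialZbar_solution hμ haS haR p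
    rw [partialZbar_eq hPd, partialZ_eq hPd] at h1
    rw [partialZbar_eq hσd, partialZ_eq hσd] at h2
    rw [partialZbar_eq hrd, partialZ_eq hrd]
    simp only [hfr]
    linear_combination Complex.exp (-σ p) * (h1 - P p * h2)
  have hrt : Tendsto (fun w => r (w, ε)) (cocompact ℂ) (𝓝 0) := by
    obtain ⟨C, hC⟩ := exists_solution_decay hμ haS haR
    obtain ⟨C₁, hC₁⟩ := exists_fderiv_solution_decay hμ hμ.smooth hμ.supp (1, 0)
    obtain ⟨C₂, hC₂⟩ := exists_fderiv_solution_decay hμ hμ.smooth hμ.supp (Complex.I, 0)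
    have h1 := tendsto_of_decay fun z => hC z ε
    have h2 := tendsto_of_decay fun z => hC₁ z ε
    have h3 := tendsto_of_decay fun z => hC₂ z ε
    have h4 := ((((h2.const_mul (1 / 2)).add (h3.const_mul (-Complex.I / 2))).const_add 1).mul
      h1.neg.cexp).sub_const 1
    simp only [hr, hP, partialZ_eq hUd]
    simpa using h4
  have h0 := eq_zero_of_beltrami_equation hμ.lt_one (contDiff_slice hμ.smooth ε)
    (hasCompactSupport_slice hμ.supp ε) (fun z => hμ.bound _) (contDiff_slice hrs ε) hrt
    (fun z => hreq (z, ε))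
  have h5 : r (z, ε) = 0 := congrFun h0 z
  intro h6
  have h7 : P (z, ε) = 0 := h6
  simp [hr, h7] at h5

/-! ### Local diffeomorphisms of the plane asymptotic to the identity -/

section Global

/-- A proper locally injective open map of the plane for which some point has at most one preimage
is bijective. -/
theorem bijective_of_proper {f : ℂ → ℂ} (hc : Continuous f) (ho : IsOpenMap f)
    (hp : Tendsto f (cocompact ℂ) (cocompact ℂ))
    (hloc : ∀ z, ∃ U ∈ 𝓝 z, InjOn f U)
    (hone : ∃ c, ∀ z z', f z = c → f z' = c → z = z') : Function.Bijective f := by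
  have hprop : IsProperMap f := isProperMap_iff_tendsto_cocompact.2 ⟨hc, hp⟩
  have hsurj : Function.Surjective f := by
    rw [← range_eq_univ]
    exact IsClopen.eq_univ ⟨hprop.isClosedMap.isClosed_range, ho.isOpen_range⟩ (range_nonempty f)
  -- Pairs of distinct points with equal image. Local injectivity keeps the diagonal away from
  -- limits of such pairs, so `Δ` is closed.
  set Δ : Set (ℂ × ℂ) := {x | x.1 ≠ x.2 ∧ f x.1 = f x.2} with hΔ
  have hΔc : IsClosed Δ := by
    rw [← isOpen_compl_iff, isOpen_iff_mem_nhds]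
    rintro ⟨z, z'⟩ hx
    by_cases hz : z = z'
    · subst hz
      obtain ⟨U, hU, hinj⟩ := hloc z
      filter_upwards [prod_mem_nhds hU hU] with y hy hyΔ
      exact hyΔ.1 (hinj hy.1 hy.2 hyΔ.2)
    · have hne : f z ≠ f z' := fun h => hx ⟨hz, h⟩
      have hopen : IsOpen {x : ℂ × ℂ | f x.1 ≠ f x.2} :=
        isOpen_ne_fun (hc.comp continuous_fst) (hc.comp continuous_snd)
      filter_upwards [hopen.mem_nhds hne] with y hy hyΔ
      exact hy hyΔ.2
  -- The values taken more than once form a clopen set: closed because `f × f` is proper and `Δ` is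
  -- closed, open because `f` is open. It misses `c`, hence is empty.
  set A : Set ℂ := {w | ∃ z z', z ≠ z' ∧ f z = w ∧ f z' = w} with hA
  have hAc : IsClosed A := by
    have h1 := (hprop.prodMap hprop).isClosedMap Δ hΔc
    have h2 : A = (fun w => (w, w)) ⁻¹' (Prod.map f f '' Δ) := by
      ext w
      constructor
      · rintro ⟨z, z', hz, h, h'⟩
        exact ⟨(z, z'), ⟨hz, h.trans h'.symm⟩, by simp [h, h']⟩
      · rintro ⟨⟨z, z'⟩, ⟨hz, h⟩, h'⟩
        simp only [Prod.map_apply, Prod.mk.injEq] at h'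
        exact ⟨z, z', hz, h'.1, h'.2⟩
    rw [h2]
    exact h1.preimage (by fun_prop)
  have hAo : IsOpen A := by
    rw [isOpen_iff_mem_nhds]
    rintro w ⟨z, z', hz, h, h'⟩
    obtain ⟨U, V, hU, hV, hzU, hzV, hUV⟩ := t2_separation hz
    have h1 : f '' U ∈ 𝓝 w := h ▸ (ho U hU).mem_nhds (mem_image_of_mem f hzU)
    have h2 : f '' V ∈ 𝓝 w := h' ▸ (ho V hV).mem_nhds (mem_image_of_mem f hzV)
    filter_upwards [h1, h2]
    rintro _ ⟨a, ha, rfl⟩ ⟨b, hb, hab⟩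
    exact ⟨a, b, fun h => hUV.ne_of_mem ha hb h, rfl, hab⟩
  refine ⟨fun z z' h => ?_, hsurj⟩
  by_contra hz
  have huniv : A = univ := IsClopen.eq_univ ⟨hAc, hAo⟩ ⟨f z, z, z', hz, rfl, h.symm⟩
  obtain ⟨c, hone⟩ := hone
  obtain ⟨a, b, hab, ha, hb⟩ : c ∈ A := huniv ▸ mem_univ c
  exact hab (hone a b ha hb)

variable {u : ℂ → ℂ}

theorem tendsto_cocompact_id_add (h0 : Tendsto u (cocompact ℂ) (𝓝 0)) :
    Tendsto (fun z => z + u z) (cocompact ℂ) (cocompact ℂ) := by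
  rw [← Metric.cobounded_eq_cocompact] at h0 ⊢
  rw [← tendsto_norm_atTop_iff_cobounded]
  have h1 : ∀ᶠ z in Bornology.cobounded ℂ, ‖u z‖ ≤ 1 := by
    have := h0.norm
    rw [norm_zero] at this
    exact this.eventually_le_const one_pos
  have h2 : Tendsto (fun z : ℂ => ‖z‖ + (-1)) (Bornology.cobounded ℂ) atTop :=
    tendsto_atTop_add_const_right _ _ tendsto_norm_cobounded_atTop
  refine tendsto_atTop_mono' _ ?_ h2
  filter_upwards [h1] with z hz
  have := norm_sub_le (z + u z) (u z)
  simp only [add_sub_cancel_right] at this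
  linarith

theorem hasStrictFDerivAt_equiv {f : ℂ → ℂ} (hf : ContDiff ℝ ∞ f) (z : ℂ)
    (hinj : Function.Injective (fderiv ℝ f z)) :
    ∃ e : ℂ ≃L[ℝ] ℂ, HasStrictFDerivAt f (e : ℂ →L[ℝ] ℂ) z := by
  refine ⟨(LinearEquiv.ofInjectiveEndo (fderiv ℝ f z : ℂ →ₗ[ℝ] ℂ) hinj).toContinuousLinearEquiv,
    ?_⟩
  have h := hf.contDiffAt.hasStrictFDerivAt (x := z) (by simp)
  exact h.congr_fderiv (ContinuousLinearMap.ext fun v => by simp)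

theorem bijective_id_add (hu : ContDiff ℝ ∞ u) {C : ℝ} (hC : ∀ z, ‖u z‖ ≤ C * (1 + ‖z‖)⁻¹)
    (hd : Tendsto (fun z => ‖fderiv ℝ u z‖) (cocompact ℂ) (𝓝 0))
    (hinj : ∀ z, Function.Injective (fderiv ℝ (fun w => w + u w) z)) :
    Function.Bijective fun z => z + u z := by
  have hf : ContDiff ℝ ∞ fun z => z + u z := contDiff_id.add hu
  choose e he using fun z => hasStrictFDerivAt_equiv hf z (hinj z)
  refine bijective_of_proper hf.continuous (isOpenMap_of_hasStrictFDerivAt_equiv he)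
    (tendsto_cocompact_id_add (tendsto_of_decay hC)) (fun z => ?_) ?_
  · exact ⟨_, ((he z).toOpenPartialHomeomorph _).open_source.mem_nhds
      (he z).mem_toOpenPartialHomeomorph_source, ((he z).toOpenPartialHomeomorph _).injOn⟩
  · have hC0 : 0 ≤ C := by
      have := (norm_nonneg _).trans (hC 0)
      simpa using this
    have hC' : ∀ z, ‖u z‖ ≤ C := fun z => (hC z).trans
      (mul_le_of_le_one_right hC0 (inv_le_one_of_one_le₀ (by linarith [norm_nonneg z])))
    have hev : ∀ᶠ z in cocompact ℂ, ‖fderiv ℝ u z‖ ≤ 1 / 2 :=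
      hd.eventually_le_const (by norm_num)
    rw [← Metric.cobounded_eq_cocompact, ← comap_norm_atTop, eventually_comap] at hev
    obtain ⟨N, hN⟩ := eventually_atTop.1 hev
    set N' := max N 0
    -- Preimages of this value lie within `2 C` of each other and have modulus at least `N' + 2 C`.
    -- The ball joining them thus stays where `u` has derivative at most `1/2`, and `z' - z = u z -
    -- u z'` forces equality.
    refine ⟨((N' + 3 * C : ℝ) : ℂ), fun z z' hz hz' => ?_⟩
    have hn : ‖((N' + 3 * C : ℝ) : ℂ)‖ = N' + 3 * C := by
      rw [Complex.norm_real, Real.norm_of_nonneg (by positivity)]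
    have h1 : N' + 2 * C ≤ ‖z‖ := by
      have h2 := norm_add_le z (u z)
      rw [hz, hn] at h2
      linarith [hC' z]
    have hdiff : z' - z = u z - u z' := by
      linear_combination hz' - hz
    have h3 : ‖z' - z‖ ≤ 2 * C := by
      rw [hdiff]
      refine (norm_sub_le _ _).trans ?_
      linarith [hC' z, hC' z']
    have h4 := (convex_closedBall z (2 * C)).norm_image_sub_le_of_norm_fderiv_le (𝕜 := ℝ)
      (f := u) (C := 1 / 2) (fun x _ => hu.differentiable (by simp) x) (fun x hx => by
        refine hN ‖x‖ ?_ x rfl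
        have h5 := norm_sub_norm_le z x
        rw [mem_closedBall_iff_norm, norm_sub_rev] at hx
        linarith [le_max_left N 0])
      (Metric.mem_closedBall_self (by positivity)) (mem_closedBall_iff_norm.2 h3)
    rw [norm_sub_rev, ← hdiff] at h4
    have h6 : ‖z' - z‖ = 0 := by linarith [norm_nonneg (z' - z)]
    exact (sub_eq_zero.1 (norm_eq_zero.1 h6)).symm

end Global

/-! ### Diffeomorphisms of the Riemann sphere -/

section Sphere

open RiemannSphere

/-- One chart suffices for both `p` and `Φ p`, because the map fixes `∞` and preserves the plane.
Smoothness of the inverse is the inverse function theorem in that chart. -/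
theorem contMDiffAt_of_chart (Φ : OnePoint ℂ ≃ₜ OnePoint ℂ) (p : OnePoint ℂ)
    (e : OpenPartialHomeomorph (OnePoint ℂ) ℂ) (hp : chartAt ℂ p = e) (hΦp : chartAt ℂ (Φ p) = e)
    (L : ℂ ≃L[ℝ] ℂ) (hL : HasFDerivAt (fun z => e (Φ (e.symm z))) (L : ℂ →L[ℝ] ℂ) (e p))
    (hs : ContDiffAt ℝ ∞ (fun z => e (Φ (e.symm z))) (e p)) :
    ContMDiffAt 𝓘(ℝ, ℂ) 𝓘(ℝ, ℂ) ∞ Φ p ∧ ContMDiffAt 𝓘(ℝ, ℂ) 𝓘(ℝ, ℂ) ∞ Φ.symm (Φ p) := by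
  have hpe : p ∈ e.source := hp ▸ mem_chart_source ℂ p
  have hΦpe : Φ p ∈ e.source := hΦp ▸ mem_chart_source ℂ (Φ p)
  constructor
  · rw [contMDiffAt_iff]
    refine ⟨Φ.continuous.continuousAt, ?_⟩
    simpa [hp, hΦp, Function.comp_def, contDiffWithinAt_univ] using! hs
  · rw [contMDiffAt_iff]
    refine ⟨Φ.symm.continuous.continuousAt, ?_⟩
    set T : OpenPartialHomeomorph ℂ ℂ :=
      (e.symm.trans Φ.toOpenPartialHomeomorph).trans e with hT
    have hTs : e p ∈ T.source := by
      simp [hT, hpe, hΦpe]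
    have hTp : T (e p) = e (Φ p) := by simp [hT, hpe]
    have hTt : e (Φ p) ∈ T.target := hTp ▸ T.map_source hTs
    have hTsymm : T.symm (e (Φ p)) = e p := by rw [← hTp, T.left_inv hTs]
    have h := T.contDiffAt_symm (n := ∞) (f₀' := L) hTt (hTsymm.symm ▸ hL) (hTsymm.symm ▸ hs)
    simpa [hp, hΦp, Function.comp_def, contDiffWithinAt_univ, hT] using! h

theorem chartAt_coe (z : ℂ) : chartAt ℂ (z : OnePoint ℂ) = affineChart :=
  if_neg (OnePoint.coe_ne_infty z)

theorem chartAt_infty : chartAt ℂ (OnePoint.infty : OnePoint ℂ) = inftyChart :=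
  if_pos rfl

variable {u : ℂ → ℂ}

/-- The extension of `z ↦ z + u z` to the Riemann sphere as a homeomorphism. -/
theorem exists_homeomorph (hu : ContDiff ℝ ∞ u) (h0 : Tendsto u (cocompact ℂ) (𝓝 0))
    (hb : Function.Bijective fun z => z + u z) :
    ∃ Φ : OnePoint ℂ ≃ₜ OnePoint ℂ, ∀ p, Φ p = OnePoint.map (fun z => z + u z) p := by
  have hc : Continuous (OnePoint.map fun z => z + u z) := by
    refine OnePoint.continuous_map (contDiff_id.add hu).continuous ?_
    rw [coclosedCompact_eq_cocompact]
    exact tendsto_cocompact_id_add h0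
  have hbij : Function.Bijective (OnePoint.map fun z => z + u z) := by
    refine ⟨Option.map_injective hb.1, ?_⟩
    intro p
    induction p using OnePoint.rec with
    | infty => exact ⟨OnePoint.infty, rfl⟩
    | coe w =>
      obtain ⟨z, hz⟩ := hb.2 w
      exact ⟨z, congrArg _ hz⟩
  exact ⟨hc.homeoOfEquivCompactToT2 (f := Equiv.ofBijective _ hbij), fun p => rfl⟩

theorem inftyChart_conj_of_ne {Φ : OnePoint ℂ ≃ₜ OnePoint ℂ}
    (hΦ : ∀ p, Φ p = OnePoint.map (fun z => z + u z) p) {ζ : ℂ} (hζ : ζ ≠ 0)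
    (h : ζ⁻¹ + u ζ⁻¹ ≠ 0) :
    inftyChart (Φ (inftyChart.symm ζ)) = (ζ⁻¹ + u ζ⁻¹)⁻¹ := by
  rw [inftyChart_symm, inversion_coe hζ, hΦ, OnePoint.map_some, inftyChart_apply,
    inversion_coe h, affineChart_coe]

theorem inftyChart_conj_zero {Φ : OnePoint ℂ ≃ₜ OnePoint ℂ}
    (hΦ : ∀ p, Φ p = OnePoint.map (fun z => z + u z) p) :
    inftyChart (Φ (inftyChart.symm 0)) = 0 := by
  rw [inftyChart_symm, inversion_zero, hΦ, OnePoint.map_infty, inftyChart_apply, inversion_infty,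
    affineChart_coe]

/-- In the coordinate `ζ = 1/z` the map is `ζ / (1 + ζ u(1/ζ))`. As `u` tends to zero at infinity,
it has derivative `1` at the origin; being holomorphic nearby, it has a removable singularity there.
-/
theorem conformal_at_infty {Φ : OnePoint ℂ ≃ₜ OnePoint ℂ}
    (hΦ : ∀ p, Φ p = OnePoint.map (fun z => z + u z) p)
    (h0 : Tendsto u (cocompact ℂ) (𝓝 0))
    (hol : ∀ᶠ z in cocompact ℂ, DifferentiableAt ℂ u z) :
    HasDerivAt (fun ζ => inftyChart (Φ (inftyChart.symm ζ))) 1 0 ∧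
      AnalyticAt ℂ (fun ζ => inftyChart (Φ (inftyChart.symm ζ))) 0 := by
  rw [← Metric.cobounded_eq_cocompact] at h0 hol
  have hinv := tendsto_inv₀_nhdsNE_zero (α := ℂ)
  set T : ℂ → ℂ := fun ζ => inftyChart (Φ (inftyChart.symm ζ)) with hT
  have hT0 : T 0 = 0 := inftyChart_conj_zero hΦ
  have h1 : Tendsto (fun ζ : ℂ => 1 + ζ * u ζ⁻¹) (𝓝[≠] 0) (𝓝 1) := by
    have h2 : Tendsto (fun ζ : ℂ => ζ) (𝓝[≠] 0) (𝓝 0) :=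
      tendsto_nhdsWithin_of_tendsto_nhds tendsto_id
    simpa using (h2.mul (h0.comp hinv)).const_add 1
  have hne : ∀ᶠ ζ : ℂ in 𝓝[≠] 0, 1 + ζ * u ζ⁻¹ ≠ 0 := h1.eventually_ne one_ne_zero
  have hTne : ∀ᶠ ζ : ℂ in 𝓝[≠] 0, T ζ = ζ * (1 + ζ * u ζ⁻¹)⁻¹ := by
    filter_upwards [hne, self_mem_nhdsWithin] with ζ hζ hζ0
    have hζ0 : ζ ≠ 0 := hζ0
    have h3 : ζ⁻¹ + u ζ⁻¹ = ζ⁻¹ * (1 + ζ * u ζ⁻¹) := by field_simp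
    rw [hT]
    simp only
    rw [inftyChart_conj_of_ne hΦ hζ0 (h3 ▸ mul_ne_zero (inv_ne_zero hζ0) hζ), h3, mul_inv, inv_inv]
  have hder : HasDerivAt T 1 0 := by
    rw [hasDerivAt_iff_tendsto_slope]
    have h4 := h1.inv₀ one_ne_zero
    rw [inv_one] at h4
    refine h4.congr' ?_
    filter_upwards [hTne, self_mem_nhdsWithin] with ζ hζ hζ0
    have hζ0 : ζ ≠ 0 := hζ0
    rw [slope_def_field, hT0, hζ]
    field_simp
    ring
  refine ⟨hder, Complex.analyticAt_of_differentiable_on_punctured_nhds_of_continuousAt ?_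
    hder.continuousAt⟩
  have hTne' := eventually_eventually_nhdsWithin.2 hTne
  filter_upwards [hTne', hne, hinv.eventually hol, self_mem_nhdsWithin] with ζ h5 h6 h7 hζ0
  have hζ0 : ζ ≠ 0 := hζ0
  have h8 : T =ᶠ[𝓝 ζ] fun ζ => ζ * (1 + ζ * u ζ⁻¹)⁻¹ := by
    rwa [(isOpen_compl_singleton (x := (0 : ℂ))).nhdsWithin_eq hζ0] at h5
  refine DifferentiableAt.congr_of_eventuallyEq ?_ h8
  have h9 : DifferentiableAt ℂ (fun ζ => u ζ⁻¹) ζ := h7.comp ζ (differentiableAt_inv hζ0)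
  exact differentiableAt_id.mul
    (((differentiableAt_const _).add (differentiableAt_id.mul h9)).inv h6)

theorem exists_diffeomorph (hu : ContDiff ℝ ∞ u) {C : ℝ} (hC : ∀ z, ‖u z‖ ≤ C * (1 + ‖z‖)⁻¹)
    (hd : Tendsto (fun z => ‖fderiv ℝ u z‖) (cocompact ℂ) (𝓝 0))
    (hinj : ∀ z, Function.Injective (fderiv ℝ (fun w => w + u w) z))
    (hol : ∀ᶠ z in cocompact ℂ, DifferentiableAt ℂ u z) :
    ∃ Φ : Diffeomorph 𝓘(ℝ, ℂ) 𝓘(ℝ, ℂ) (OnePoint ℂ) (OnePoint ℂ) ∞,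
      ∀ p, Φ p = OnePoint.map (fun z => z + u z) p := by
  have h0 := tendsto_of_decay hC
  have hf : ContDiff ℝ ∞ fun z => z + u z := contDiff_id.add hu
  obtain ⟨Φ, hΦ⟩ := exists_homeomorph hu h0 (bijective_id_add hu hC hd hinj)
  have key : ∀ p, ContMDiffAt 𝓘(ℝ, ℂ) 𝓘(ℝ, ℂ) ∞ Φ p ∧
      ContMDiffAt 𝓘(ℝ, ℂ) 𝓘(ℝ, ℂ) ∞ Φ.symm (Φ p) := by
    intro p
    induction p using OnePoint.rec with
    | infty =>
      obtain ⟨h1, h2⟩ := conformal_at_infty hΦ h0 hol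
      have hi : Φ OnePoint.infty = OnePoint.infty := by rw [hΦ, OnePoint.map_infty]
      have he : inftyChart OnePoint.infty = 0 := by
        rw [inftyChart_apply, inversion_infty, affineChart_coe]
      refine contMDiffAt_of_chart Φ _ inftyChart chartAt_infty (hi.symm ▸ chartAt_infty)
        (ContinuousLinearEquiv.refl ℝ ℂ) ?_ ?_
      · rw [he]
        exact (h1.hasFDerivAt.restrictScalars ℝ).congr_fderiv
          (ContinuousLinearMap.ext fun v => by simp)
      · rw [he]
        exact h2.contDiffAt.restrict_scalars ℝ
    | coe z =>
      have hz : Φ z = ((z + u z : ℂ) : OnePoint ℂ) := by rw [hΦ, OnePoint.map_some]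
      have hT : (fun w => affineChart (Φ (affineChart.symm w))) = fun w => w + u w := by
        ext w
        rw [affineChart_symm, hΦ, OnePoint.map_some, affineChart_coe]
      obtain ⟨e, he⟩ := hasStrictFDerivAt_equiv hf z (hinj z)
      refine contMDiffAt_of_chart Φ _ affineChart (chartAt_coe z) (hz.symm ▸ chartAt_coe _) e ?_ ?_
      · rw [hT, affineChart_coe]
        exact he.hasFDerivAt
      · rw [hT, affineChart_coe]
        exact hf.contDiffAt
  refine ⟨⟨Φ.toEquiv, fun p => (key p).1, fun q => ?_⟩, hΦ⟩
  have := (key (Φ.symm q)).2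
  rwa [Φ.apply_symm_apply] at this

end Sphere

/-! ### Invertible differential and the diffeomorphism `z + u` -/

section Main

variable {R k : ℝ} {μ : ℂ × ℝ → ℂ}

theorem real_linear_apply (A : ℂ →L[ℝ] ℂ) (v : ℂ) :
    A v = v.re * A 1 + v.im * A Complex.I := by
  have h : v = v.re • (1 : ℂ) + v.im • Complex.I := by
    simp
  conv_lhs => rw [h, map_add, map_smul, map_smul]
  simp

theorem norm_le_of_basis_complex (A : ℂ →L[ℝ] ℂ) : ‖A‖ ≤ ‖A 1‖ + ‖A Complex.I‖ := by
  refine A.opNorm_le_bound (by positivity) fun v => ?_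
  rw [real_linear_apply A v]
  refine (norm_add_le _ _).trans ?_
  rw [norm_mul, norm_mul, Complex.norm_real, Complex.norm_real, add_mul, mul_comm ‖v.re‖,
    mul_comm ‖v.im‖]
  gcongr
  · exact Complex.abs_re_le_norm v
  · exact Complex.abs_im_le_norm v

/-- The differential is `v ↦ P v + μ P conj(v)` with `P ≠ 0`; a kernel vector would satisfy `|P v| ≤
k |P v|` with `k < 1`. -/
theorem injective_fderiv_id_add_solution (hμ : IsCoefficient R k μ) (ε : ℝ) (z : ℂ) :
    Function.Injective (fderiv ℝ (fun w => w + solution μ μ (w, ε)) z) := by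
  have hS := contDiff_solution hμ hμ.smooth hμ.supp
  have hd := (contDiff_slice hS ε).differentiable (by simp) z
  set A := fderiv ℝ (fun w => solution μ μ (w, ε)) z with hA
  set P := 1 + partialZ (solution μ μ) (z, ε) with hP
  have hP0 : P ≠ 0 := one_add_partialZ_solution_ne_zero hμ z ε
  have hPA : P = 1 + (A 1 - Complex.I * A Complex.I) / 2 := rfl
  have hbar : (A 1 + Complex.I * A Complex.I) / 2 = μ (z, ε) * P := by
    have h : (A 1 + Complex.I * A Complex.I) / 2 = _ :=
      partialZbar_solution hμ hμ.smooth hμ.supp (z, ε)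
    rw [h, hP]
    ring
  have hfd : fderiv ℝ (fun w => w + solution μ μ (w, ε)) z = ContinuousLinearMap.id ℝ ℂ + A := by
    rw [fderiv_fun_add differentiableAt_fun_id hd, fderiv_fun_id]
  rw [hfd, injective_iff_map_eq_zero]
  intro v hv
  have hv' : P * v = -(μ (z, ε) * P * starRingEnd ℂ v) := by
    rw [add_apply, real_linear_apply A v] at hv
    have h1 : (v.re : ℂ) + v.im * Complex.I = v := Complex.re_add_im v
    have h2 : (v.re : ℂ) - v.im * Complex.I = starRingEnd ℂ v := by
      apply Complex.ext <;> simp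
    simp only [ContinuousLinearMap.id_apply] at hv
    rw [← hbar, hPA, ← h2]
    linear_combination hv - (1 / 2 : ℂ) * (A 1 - Complex.I * A Complex.I) * h1 -
      v.im * A Complex.I * Complex.I_mul_I
  have h3 : ‖P‖ * ‖v‖ ≤ k * (‖P‖ * ‖v‖) := by
    have h5 := congrArg norm hv'
    rw [norm_neg, norm_mul, norm_mul, norm_mul, RCLike.norm_conj, mul_assoc] at h5
    calc ‖P‖ * ‖v‖ = ‖μ (z, ε)‖ * (‖P‖ * ‖v‖) := h5
      _ ≤ _ := by
          gcongr
          exact hμ.bound _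
  by_contra hv0
  have h4 : 0 < ‖P‖ * ‖v‖ := mul_pos (norm_pos_iff.2 hP0) (norm_pos_iff.2 hv0)
  nlinarith [hμ.lt_one]

theorem exists_diffeomorph_solution (hμ : IsCoefficient R k μ) (ε : ℝ) :
    ∃ Φ : Diffeomorph 𝓘(ℝ, ℂ) 𝓘(ℝ, ℂ) (OnePoint ℂ) (OnePoint ℂ) ∞,
      ∀ p, Φ p = OnePoint.map (fun z => z + solution μ μ (z, ε)) p := by
  have hS := contDiff_solution hμ hμ.smooth hμ.supp
  have hSd : Differentiable ℝ (solution μ μ) := hS.differentiable (by simp)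
  obtain ⟨C, hC⟩ := exists_solution_decay hμ hμ.smooth hμ.supp
  obtain ⟨C₁, hC₁⟩ := exists_fderiv_solution_decay hμ hμ.smooth hμ.supp (1, 0)
  obtain ⟨C₂, hC₂⟩ := exists_fderiv_solution_decay hμ hμ.smooth hμ.supp (Complex.I, 0)
  refine exists_diffeomorph (contDiff_slice hS ε) (fun z => hC z ε) ?_
    (injective_fderiv_id_add_solution hμ ε) ?_
  · have h := ((tendsto_of_decay fun z => hC₁ z ε).norm).add
      ((tendsto_of_decay fun z => hC₂ z ε).norm)
    rw [norm_zero, add_zero] at h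
    refine squeeze_zero (fun _ => norm_nonneg _) (fun z => ?_) h
    rw [← fderiv_slice hSd, ← fderiv_slice hSd]
    exact norm_le_of_basis_complex _
  -- Outside the support of `μ` the Beltrami equation reads `∂_{z̄} u = 0`, so `u` is holomorphic
  -- near infinity.
  · have h : ∀ᶠ z : ℂ in cocompact ℂ, R < ‖z‖ :=
      (tendsto_norm_cocompact_atTop).eventually_gt_atTop R
    filter_upwards [h] with z hz
    rw [differentiableAt_complex_iff_differentiableAt_real]
    refine ⟨(contDiff_slice hS ε).differentiable (by simp) z, ?_⟩
    have h1 : dzbar (fun w => solution μ μ (w, ε)) z = 0 := by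
      have h2 : dzbar (fun w => solution μ μ (w, ε)) z = _ :=
        partialZbar_solution hμ hμ.smooth hμ.supp (z, ε)
      rw [h2, slice_eq_zero hμ.supp ε z hz, zero_mul, add_zero]
    rw [dzbar] at h1
    rw [smul_eq_mul]
    linear_combination (-2 * Complex.I) * h1 +
      fderiv ℝ (fun w => solution μ μ (w, ε)) z Complex.I * Complex.I_mul_I

end Main

end Beltrami

theorem proposition3p1 (μ : ℂ × ℝ → ℂ) (hsmooth : ContDiff ℝ ∞ μ) (hsupp : HasCompactSupport μ)
    (hnorm : MeasureTheory.eLpNorm μ ⊤ MeasureTheory.volume < 1) :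
    -- all terms and the sum are smooth functions of `(z, ε)`, the `v_n` compactly supported
    (∀ n : ℕ, ContDiff ℝ ∞ (Beltrami.v μ n) ∧ HasCompactSupport (Beltrami.v μ n) ∧
      ContDiff ℝ ∞ (Beltrami.uTerm μ n)) ∧
    ContDiff ℝ ∞ (Beltrami.uSum μ) ∧
    -- the series converges to `u` uniformly on `ℂ × ℝ` together with all its derivatives
    (∀ l : ℕ × ℕ × ℕ, TendstoUniformly
      (fun (N : ℕ) (p : ℂ × ℝ) => ∑ n ∈ Finset.range N, Beltrami.D l (Beltrami.uTerm μ n) p)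
      (Beltrami.D l (Beltrami.uSum μ)) Filter.atTop) ∧
    -- `u` solves `(1 - 𝒞 μ ∂_z) u = 𝒞 μ`
    (∀ (z : ℂ) (ε : ℝ), Beltrami.uSum μ (z, ε) -
        Beltrami.cauchy (fun w => μ (w, ε) * Beltrami.partialZ (Beltrami.uSum μ) (w, ε)) z =
      Beltrami.cauchy (fun w => μ (w, ε)) z) ∧
    -- decay of all derivatives, uniformly in `ε` and in `n`
    (∀ l : ℕ × ℕ × ℕ, ∃ C : ℝ, ∀ (z : ℂ) (ε : ℝ),
      ‖Beltrami.D l (Beltrami.uSum μ) (z, ε)‖ ≤ C * (1 + ‖z‖)⁻¹ ∧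
      ∀ n : ℕ, ‖Beltrami.D l (Beltrami.uTerm μ n) (z, ε)‖ ≤ C * (1 + ‖z‖)⁻¹) ∧
    -- `z ↦ z + u(z, ε)`, with `∞ ↦ ∞`, is a smooth diffeomorphism of the Riemann sphere
    (∀ ε : ℝ, ∃ Φ : Diffeomorph 𝓘(ℝ, ℂ) 𝓘(ℝ, ℂ) (OnePoint ℂ) (OnePoint ℂ) ∞,
      ∀ p : OnePoint ℂ, Φ p = OnePoint.map (fun z : ℂ => z + Beltrami.uSum μ (z, ε)) p) := by
  open Beltrami in
  obtain ⟨R, k, hμ⟩ := exists_isCoefficient hsmooth hsupp hnorm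
  have hG := geomDecayAll_neumann hμ hμ.smooth hμ.supp
  -- Convergence and decay of all derivatives both follow from this: `D l` acts term by term and
  -- preserves the geometric bounds.
  have hD : ∀ l, GeomDecayAll (fun n => D l (uTerm μ n)) ∧
      D l (uSum μ) = fun p => ∑' n, D l (uTerm μ n) p := by
    intro l
    simp only [uTerm_eq, uSum_eq]
    exact termByTerm_D l _ hG
  refine ⟨fun n => ?_, ?_, fun l => ?_, fun z ε => ?_, fun l => ?_, fun ε => ?_⟩
  · obtain ⟨h1, h2⟩ := neumann_spec hμ hμ.smooth hμ.supp n
    rw [v_eq_neumann, uTerm_eq]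
    exact ⟨h1, hasCompactSupport_of_supported h2, hG.self.smooth n⟩
  · rw [uSum_eq]
    exact contDiff_solution hμ hμ.smooth hμ.supp
  · rw [(hD l).2]
    exact (hD l).1.self.tendstoUniformly
  · rw [uSum_eq, solution_eq_cauchy hμ hμ.smooth hμ.supp z ε]
    ring
  · rw [(hD l).2]
    exact (hD l).1.self.exists_tsum_bound
  · rw [uSum_eq]
    exact exists_diffeomorph_solution hμ ε
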